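/- **Setting.** Fix countably infinite, pairwise disjoint sets $N_I$ (individual names), $N_C$ (concept names), $N_P$ (role names), $N_V$ (variables), and sets of *rigid* concept names and of *rigid* role names; all other names are *flexible*. A *role* is $P$ or $P^-$ with $P\in N_P$ (with $(P^-)^-=P$), rigid iff $P$ is; a *basic concept* is $A\in N_C$ or $\exists R$ for a role $R$, rigid iff the name in it is. A DL-Lite$^{\mathcal H}_{horn}$ *ontology* $O$ is a finite set of role inclusions $S\sqsubseteq R$ and of concept inclusions $B_1\sqcap\dots\sqcap B_m\sqsubseteq B$ or $B_1\sqcap\dots\sqcap B_m\sqsubseteq\bot$ ($m\ge 0$, basic concepts $B_j,B$). *Positive assertions* are $B(a)$ and $R(a,b)$; *assertions* are positive assertions and their negations; an ABox is a set of assertions. Interpretations have non-empty domains, satisfy the unique name assumption, and interpret everything as usual. Let $\mathcal K=\langle O,(\mathcal A_i)_{0\le i\le n}\rangle$ be a temporal knowledge base with $O$ as above and finite ABoxes $\mathcal A_i$, all of whose concept and role names occur in $O$; $N_I(\mathcal K)$ is the set of individual names in the $\mathcal A_i$. Let $\Phi$ be a Boolean temporal conjunctive query, i.e. built from Boolean CQs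 by $\neg,\wedge$, next, previous, until, since, and let $Q_\Phi$ be its finite set of CQs. A Boolean CQ is a finite set of atoms $B(t)$, $R(s,t)$, with all its variables existentially quantified; $N_T(\varphi)$ is its set of terms. The CQs in $Q_\Phi$ are connected, distinct ones have no variable in common, their individual names belong to $N_I(\mathcal K)$, and their concept and role names occur in $O$. Let $\mathcal W=\{W_1,\dots,W_k\}$, where each world $W_l$ is identified with the set of those $\varphi\in Q_\Phi$ whose propositional variable it contains, and $\iota:\{0,\dots,n\}\to\{1,\dots,k\}$. Extend both to $0\le i\le n+k$ by $\iota(n+l)=l$ and $\mathcal A_{n+l}=\emptyset$ for $1\le l\le k$. $\mathcal W$ is *r-satisfiable* w.r.t. $\iota$ and $\mathcal K$ if there are interpretations $\mathcal J_0,\dots,\mathcal J_{n+k}$ over one domain that agree on all individual names and all rigid names, such that each $\mathcal J_i$ is a model of $\langle O,\mathcal A_i\rangle$, of every $\varphi\in W_{\iota(i)}$, and of no $\varphi\in Q_\Phi\setminus W_{\iota(i)}$. **Auxiliary notions.** * Extend $N_I$ by fresh, pairwise distinct names $a_x$ for variables $x$, and tree names $a_{b\rho}$ for $b$ an individual name or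 a name $a_x$ and $\rho$ a non-empty word of roles; put $a_{b\varepsilon}=b$. Let $N_I^{aux}$ be the set of the names $a_x$ with $x$ a variable of a query in $Q_\Phi$. In knowledge bases over the extended names the unique name assumption covers these too. * $\mathcal A_\varphi$ is the set of atoms of $\varphi$ with every variable $x$ replaced by $a_x$; $\mathcal A_Q=\bigcup_{\varphi\in Q}\mathcal A_\varphi$. * The *rigid consequences* $\mathcal A^R_Q$ of $Q\subseteq Q_\Phi$: all positive rigid assertions $\alpha$ over the names of $O$ and the individual names of $\mathcal A_\varphi$ with $\langle O,\mathcal A_\varphi\rangle\models\alpha$, for some $\varphi\in Q$. * A *rigid ABox type* for $\mathcal K$ is a set $\mathcal A_R$ of rigid assertions over $N_I(\mathcal K)$ and the names of $O$ that contains, for each positive such assertion $\alpha$, exactly one of $\alpha$, $\neg\alpha$. * Let $d=\max_{\varphi\in Q_\Phi}|N_T(\varphi)|$. For a role $S$ and $b$ in $N_I(\mathcal K)\cup N_I^{aux}$, $\mathcal A_{\exists S(b)}$ consists of the following assertions, for all words of roles $\rho=\sigma T=R_1\dots R_\ell$ over the role names of $O$ with $1\le\ell\le d$, $R_1=S$ and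 $O\models\exists R_j^-\sqsubseteq\exists R_{j+1}$ for $1\le j<\ell$: all $B(a_{b\rho})$ with $B$ a rigid basic concept over the names of $O$ and $O\models\exists T^-\sqsubseteq B$; and all $R(a_{b\sigma},a_{b\rho})$ with $R$ a rigid role over the names of $O$ and $O\models T\sqsubseteq R$. For a set $\mathcal R_F$ of assertions $\exists S(b)$, $\mathcal A_{\mathcal R_F}$ is the union of their $\mathcal A_{\exists S(b)}$. * A *rigid witness query* for a CQ $\varphi$ w.r.t. $O$ is a Boolean CQ $\psi$ over rigid concept and role names with $|N_T(\psi)|\le|N_T(\varphi)|$ such that every model of $O$ that satisfies $\psi$ satisfies $\varphi$. For given $\mathcal A_R$, $Q_R$, $\mathcal R_F$ and $0\le i\le n+k$ let $$\mathcal K_0^i=\langle O,\ \mathcal A_R\cup\mathcal A^R_{Q_R}\cup\mathcal A_{W_{\iota(i)}}\cup\mathcal A_i\rangle,\qquad \mathcal K_R^i=\langle O,\ \mathcal A_R\cup\mathcal A^R_{Q_R}\cup\mathcal A_{W_{\iota(i)}}\cup\mathcal A_i\cup\mathcal A_{\mathcal R_F}\rangle .$$ A tuple $(\mathcal A_R,Q_R,Q_R^\neg,\mathcal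 R_F)$ is *r-complete* w.r.t. $\mathcal W$ and $\iota$ if $\mathcal A_R$ is a rigid ABox type for $\mathcal K$, $Q_R,Q_R^\neg\subseteq Q_\Phi$, $\mathcal R_F$ is a set of assertions $\exists S(b)$ with $S$ a flexible role over the role names of $O$ and $b\in N_I(\mathcal K)\cup N_I^{aux}$, and for all $0\le i\le n+k$: 1. $\mathcal K_R^i$ is consistent; 2. $\mathcal K_R^i\not\models\varphi$ for all $\varphi\in Q_\Phi\setminus W_{\iota(i)}$; 3. $W_{\iota(i)}\subseteq Q_R$; 4. $Q_\Phi\setminus W_{\iota(i)}\subseteq Q_R^\neg$; 5. $\mathcal K_R^i\not\models\psi$ for every rigid witness query $\psi$ w.r.t. $O$ of every $\varphi\in Q_R^\neg$; and, moreover, 6. for every flexible role $S$ over the role names of $O$ and every $b\in N_I(\mathcal K)\cup N_I^{aux}$: $\exists S(b)\in\mathcal R_F$ iff $\mathcal K_0^j\models\exists S(b)$ for some $0\le j\le n+k$. **Lemma.** $\mathcal W$ is r-satisfiable w.r.t. $\iota$ and $\mathcal K$ if and only if there is an r-complete tuple w.r.t. $\mathcal W$ and $\iota$. -/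

import Mathlib

/-! Syntax and semantics of the extended DL-Lite family, Boolean conjunctive queries, temporal
conjunctive queries, r-satisfiability and r-complete tuples.

`I` is a type of individual names, `C` of concept names, `P` of role names, `V` of variables. -/

namespace DLLite

/-! ### Syntax of DL-Lite -/

/-- Roles `P` and `P⁻`. -/
inductive Role (P : Type) : Type
  | prim (p : P) : Role P
  | inv (p : P) : Role P

/-- The inverse of a role, with `(P⁻)⁻ = P`. -/
def Role.inverse {P : Type} : Role P → Role P
  | .prim p => .inv p
  | .inv p => .prim p

/-- The role name from which a role is built. -/
def Role.name {P : Type} : Role P → P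
  | .prim p => p
  | .inv p => p

/-- Basic concepts `A` and `∃R`. -/
inductive BasicConcept (C P : Type) : Type
  | atomic (A : C) : BasicConcept C P
  | ex (R : Role P) : BasicConcept C P

/-- Concept inclusions: the conjunction of `lhs` is subsumed by the disjunction of `rhs`. -/
structure CI (C P : Type) : Type where
  lhs : Finset (BasicConcept C P)
  rhs : Finset (BasicConcept C P)

/-- Role inclusions `sub ⊑ sup`. -/
structure RI (P : Type) : Type where
  sub : Role P
  sup : Role P

/-- An ontology is a finite set of concept and role inclusions. -/
structure Ontology (C P : Type) : Type where
  cis : Finset (CI C P)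
  ris : Finset (RI P)

/-- The ontology belongs to the Horn fragment with role inclusions: every right-hand side of a
concept inclusion has at most one disjunct. -/
def Ontology.IsHorn {C P : Type} (O : Ontology C P) : Prop :=
  ∀ α ∈ O.cis, α.rhs.card ≤ 1

/-- Positive assertions `B(a)` and `R(a,b)`. -/
inductive Fact (I C P : Type) : Type
  | conc (B : BasicConcept C P) (a : I) : Fact I C P
  | role (R : Role P) (a b : I) : Fact I C P

/-- Assertions: positive assertions and their negations. -/
inductive Assertion (I C P : Type) : Type
  | pos (α : Fact I C P) : Assertion I C P
  | neg (α : Fact I C P) : Assertion I C P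

/-- The positive assertion underlying an assertion. -/
def Assertion.fact {I C P : Type} : Assertion I C P → Fact I C P
  | .pos α => α
  | .neg α => α

/-- Renaming of individual names in a positive assertion. -/
def Fact.map {I I' C P : Type} (f : I → I') : Fact I C P → Fact I' C P
  | .conc B a => .conc B (f a)
  | .role R a b => .role R (f a) (f b)

/-- Renaming of individual names in an assertion. -/
def Assertion.map {I I' C P : Type} (f : I → I') : Assertion I C P → Assertion I' C P
  | .pos α => .pos (α.map f)
  | .neg α => .neg (α.map f)

/-! ### Which names occur -/

/-- The basic concept is built from concept names in `SC` and role names in `SP`. -/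
def BasicConcept.BuiltFrom {C P : Type} (SC : Set C) (SP : Set P) : BasicConcept C P → Prop
  | .atomic A => A ∈ SC
  | .ex R => R.name ∈ SP

/-- The positive assertion is built from individual names in `SI`, concept names in `SC` and role
names in `SP`. -/
def Fact.BuiltFrom {I C P : Type} (SI : Set I) (SC : Set C) (SP : Set P) : Fact I C P → Prop
  | .conc B a => B.BuiltFrom SC SP ∧ a ∈ SI
  | .role R a b => R.name ∈ SP ∧ a ∈ SI ∧ b ∈ SI

/-- The individual names in a positive assertion. -/
def Fact.inds {I C P : Type} : Fact I C P → Set I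
  | .conc _ a => {a}
  | .role _ a b => {a, b}

/-- The concept names occurring in an ontology. -/
def Ontology.conceptNames {C P : Type} (O : Ontology C P) : Set C :=
  {A | ∃ α ∈ O.cis, BasicConcept.atomic A ∈ α.lhs ∨ BasicConcept.atomic A ∈ α.rhs}

/-- The role names occurring in an ontology. -/
def Ontology.roleNames {C P : Type} (O : Ontology C P) : Set P :=
  {p | (∃ α ∈ O.cis, ∃ R : Role P, R.name = p ∧
          (BasicConcept.ex R ∈ α.lhs ∨ BasicConcept.ex R ∈ α.rhs)) ∨
       (∃ α ∈ O.ris, α.sub.name = p ∨ α.sup.name = p)}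

/-! ### Semantics of DL-Lite -/

/-- Interpretations with domain `Δ`, under the unique name assumption. -/
structure Interp (I C P Δ : Type) : Type where
  nonempty : Nonempty Δ
  ind : I → Δ
  una : Function.Injective ind
  conc : C → Set Δ
  prim : P → Set (Δ × Δ)

namespace Interp

variable {I I' C P Δ : Type}

/-- Extension of a role. -/
def role (M : Interp I C P Δ) : Role P → Set (Δ × Δ)
  | .prim p => M.prim p
  | .inv p => {q | (q.2, q.1) ∈ M.prim p}

/-- Extension of a basic concept. -/
def basic (M : Interp I C P Δ) : BasicConcept C P → Set Δ
  | .atomic A => M.conc A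
  | .ex R => {x | ∃ y, (x, y) ∈ M.role R}

/-- Satisfaction of a concept inclusion. -/
def SatCI (M : Interp I C P Δ) (α : CI C P) : Prop :=
  ∀ x, (∀ B ∈ α.lhs, x ∈ M.basic B) → ∃ B ∈ α.rhs, x ∈ M.basic B

/-- Satisfaction of a role inclusion. -/
def SatRI (M : Interp I C P Δ) (α : RI P) : Prop :=
  M.role α.sub ⊆ M.role α.sup

/-- Satisfaction of an ontology. -/
def SatOntology (M : Interp I C P Δ) (O : Ontology C P) : Prop :=
  (∀ α ∈ O.cis, M.SatCI α) ∧ (∀ α ∈ O.ris, M.SatRI α)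

/-- Satisfaction of a positive assertion. -/
def SatFact (M : Interp I C P Δ) : Fact I C P → Prop
  | .conc B a => M.ind a ∈ M.basic B
  | .role R a b => (M.ind a, M.ind b) ∈ M.role R

/-- Satisfaction of an assertion. -/
def SatAssertion (M : Interp I C P Δ) : Assertion I C P → Prop
  | .pos α => M.SatFact α
  | .neg α => ¬ M.SatFact α

/-- Satisfaction of a set of assertions. -/
def SatABox (M : Interp I C P Δ) (A : Set (Assertion I C P)) : Prop :=
  ∀ α ∈ A, M.SatAssertion α

/-- The same interpretation, with fewer individual names. -/
def reduct (M : Interp I' C P Δ) (f : I → I') (hf : Function.Injective f) :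
    Interp I C P Δ where
  nonempty := M.nonempty
  ind := M.ind ∘ f
  una := M.una.comp hf
  conc := M.conc
  prim := M.prim

end Interp

/-- A knowledge base: an ontology together with a set of assertions. -/
structure KB (I C P : Type) : Type where
  onto : Ontology C P
  abox : Set (Assertion I C P)

/-- The interpretation is a model of the knowledge base. -/
def Interp.IsModel {I C P Δ : Type} (M : Interp I C P Δ) (K : KB I C P) : Prop :=
  M.SatOntology K.onto ∧ M.SatABox K.abox

/-- The knowledge base has a model. -/
def KB.Consistent {I C P : Type} (K : KB I C P) : Prop :=
  ∃ (Δ : Type) (M : Interp I C P Δ), M.IsModel K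

/-- The knowledge base entails the positive assertion. -/
def KB.EntailsFact {I C P : Type} (K : KB I C P) (α : Fact I C P) : Prop :=
  ∀ (Δ : Type) (M : Interp I C P Δ), M.IsModel K → M.SatFact α

/-- `O ⊨ B ⊑ B'`, for interpretations of the individual names `I`. -/
def Ontology.EntailsSub {C P : Type} (I : Type) (O : Ontology C P)
    (B B' : BasicConcept C P) : Prop :=
  ∀ (Δ : Type) (M : Interp I C P Δ), M.SatOntology O → M.basic B ⊆ M.basic B'

/-- `O ⊨ S ⊑ R`, for interpretations of the individual names `I`. -/
def Ontology.EntailsRI {C P : Type} (I : Type) (O : Ontology C P) (S R : Role P) : Prop :=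
  ∀ (Δ : Type) (M : Interp I C P Δ), M.SatOntology O → M.role S ⊆ M.role R

/-! ### Conjunctive queries and temporal conjunctive queries -/

/-- Terms: individual names and variables. -/
inductive Term (I V : Type) : Type
  | ind (a : I) : Term I V
  | var (x : V) : Term I V

/-- Atoms of conjunctive queries; basic concepts and inverse roles are allowed. -/
inductive Atom (I V C P : Type) : Type
  | conc (B : BasicConcept C P) (t : Term I V) : Atom I V C P
  | role (R : Role P) (s t : Term I V) : Atom I V C P

/-- The terms in an atom. -/
def Atom.terms {I V C P : Type} : Atom I V C P → Set (Term I V)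
  | .conc _ t => {t}
  | .role _ s t => {s, t}

/-- The atom is built from concept names in `SC` and role names in `SP`. -/
def Atom.BuiltFrom {I V C P : Type} (SC : Set C) (SP : Set P) : Atom I V C P → Prop
  | .conc B _ => B.BuiltFrom SC SP
  | .role R _ _ => R.name ∈ SP

/-- Boolean conjunctive queries: a finite conjunction of atoms, given as the set of these atoms, in
which all variables are existentially quantified. -/
abbrev CQ (I V C P : Type) : Type := Finset (Atom I V C P)

/-- The terms of a query. -/
def CQ.terms {I V C P : Type} (φ : CQ I V C P) : Set (Term I V) :=
  {t | ∃ α ∈ φ, t ∈ α.terms}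

/-- The query uses only concept names in `SC` and role names in `SP`. -/
def CQ.BuiltFrom {I V C P : Type} (SC : Set C) (SP : Set P) (φ : CQ I V C P) : Prop :=
  ∀ α ∈ φ, α.BuiltFrom SC SP

/-- The query is connected: any two of its terms are linked by a series of role atoms. -/
def CQ.Connected {I V C P : Type} (φ : CQ I V C P) : Prop :=
  ∀ s ∈ CQ.terms φ, ∀ t ∈ CQ.terms φ,
    Relation.ReflTransGen
      (fun u v => ∃ R : Role P, Atom.role R u v ∈ φ ∨ Atom.role R v u ∈ φ) s t

/-- `π` satisfies the atom in `M`. -/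
def Interp.SatAtom {I V C P Δ : Type} (M : Interp I C P Δ) (π : Term I V → Δ) :
    Atom I V C P → Prop
  | .conc B t => π t ∈ M.basic B
  | .role R s t => (π s, π t) ∈ M.role R

/-- `M` is a model of the Boolean query `φ`: there is a homomorphism of `φ` into `M`. -/
def Interp.SatCQ {I V C P Δ : Type} (M : Interp I C P Δ) (φ : CQ I V C P) : Prop :=
  ∃ π : Term I V → Δ, (∀ a, π (.ind a) = M.ind a) ∧ ∀ α ∈ φ, M.SatAtom π α

/-- Boolean temporal conjunctive queries. -/
inductive TCQ (I V C P : Type) : Type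
  | cq (φ : CQ I V C P) : TCQ I V C P
  | not (Φ : TCQ I V C P) : TCQ I V C P
  | and (Φ Ψ : TCQ I V C P) : TCQ I V C P
  | next (Φ : TCQ I V C P) : TCQ I V C P
  | previous (Φ : TCQ I V C P) : TCQ I V C P
  | until (Φ Ψ : TCQ I V C P) : TCQ I V C P
  | since (Φ Ψ : TCQ I V C P) : TCQ I V C P

/-- The conjunctive queries occurring in a temporal conjunctive query. -/
def TCQ.cqs {I V C P : Type} : TCQ I V C P → Set (CQ I V C P)
  | .cq φ => {φ}
  | .not Φ => Φ.cqs
  | .and Φ Ψ => Φ.cqs ∪ Ψ.cqs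
  | .next Φ => Φ.cqs
  | .previous Φ => Φ.cqs
  | .until Φ Ψ => Φ.cqs ∪ Ψ.cqs
  | .since Φ Ψ => Φ.cqs ∪ Ψ.cqs

/-! ### Temporal knowledge bases and r-satisfiability -/

/-- Temporal knowledge bases `⟨O, (A₀, …, Aₙ)⟩`. -/
structure TKB (I C P : Type) : Type where
  onto : Ontology C P
  n : ℕ
  abox : Fin (n + 1) → Finset (Assertion I C P)

/-- The individual names occurring in a temporal knowledge base. -/
def TKB.inds {I C P : Type} (K : TKB I C P) : Set I :=
  {a | ∃ i, ∃ α ∈ K.abox i, a ∈ α.fact.inds}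

/-- All concept and role names of the ABoxes occur in the ontology. -/
def TKB.NamesInOntology {I C P : Type} (K : TKB I C P) : Prop :=
  ∀ i, ∀ α ∈ K.abox i, α.fact.BuiltFrom Set.univ K.onto.conceptNames K.onto.roleNames

/-- The ABox at each of the time points `0, …, n + k`; it is empty after `n`. -/
def TKB.aboxAt {I C P : Type} (K : TKB I C P) (k : ℕ) :
    Fin (K.n + 1 + k) → Set (Assertion I C P) :=
  Fin.addCases (fun i => (K.abox i : Set (Assertion I C P))) (fun _ => ∅)

/-- The world at each of the time points `0, …, n + k`: at `i ≤ n` it is the one selected by `ι`,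
and the `k` additional time points run through all worlds. A world is given by the set of queries
whose propositional variables it contains. -/
def worldAt {I V C P : Type} {n k : ℕ} (W : Fin k → Set (CQ I V C P))
    (ι : Fin (n + 1) → Fin k) : Fin (n + 1 + k) → Set (CQ I V C P) :=
  fun i => W (Fin.addCases (motive := fun _ => Fin k) ι id i)

/-- Interpretations over one domain agree on all individual names and on all rigid concept and
role names. -/
def RespectRigid {I C P Δ T : Type} (RC : Set C) (RR : Set P) (J : T → Interp I C P Δ) : Prop :=
  ∀ i j, (J i).ind = (J j).ind ∧ (∀ A ∈ RC, (J i).conc A = (J j).conc A) ∧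
    (∀ p ∈ RR, (J i).prim p = (J j).prim p)

/-- The worlds `W 0, …, W (k - 1)` are r-satisfiable w.r.t. `ι` and the temporal knowledge base. -/
def RSatisfiable {I V C P : Type} (RC : Set C) (RR : Set P) (K : TKB I C P)
    (Φ : TCQ I V C P) {k : ℕ} (W : Fin k → Set (CQ I V C P)) (ι : Fin (K.n + 1) → Fin k) :
    Prop :=
  ∃ (Δ : Type) (J : Fin (K.n + 1 + k) → Interp I C P Δ),
    RespectRigid RC RR J ∧
    ∀ i, (J i).SatOntology K.onto ∧ (J i).SatABox (K.aboxAt k i) ∧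
      (∀ φ ∈ worldAt W ι i, (J i).SatCQ φ) ∧
      (∀ φ ∈ Φ.cqs \ worldAt W ι i, ¬ (J i).SatCQ φ)

/-! ### The ABoxes used in r-complete tuples -/

/-- Extended individual names. For the empty path, the root `.ind a` stands for the individual name
`a` itself and the root `.var x` for the auxiliary individual name `a_x`; for a nonempty path `ρ` and
a root `b`, this is the tree individual name `a_{bρ}`. -/
structure XInd (I V P : Type) : Type where
  root : Term I V
  path : List (Role P)

/-- The original individual names among the extended ones. -/
def XInd.ofInd {I V P : Type} (a : I) : XInd I V P := ⟨.ind a, []⟩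

/-- The extended name of a term: `a` for an individual name `a`, and `a_x` for a variable `x`. -/
def XInd.ofTerm {I V P : Type} (t : Term I V) : XInd I V P := ⟨t, []⟩

theorem XInd.ofInd_injective {I V P : Type} :
    Function.Injective (XInd.ofInd : I → XInd I V P) := by
  intro a b h
  have h1 := congrArg XInd.root h
  simpa [XInd.ofInd] using h1

/-- A knowledge base over the extended names entails a query over the original names. -/
def KB.EntailsCQ {I V C P : Type} (K : KB (XInd I V P) C P) (φ : CQ I V C P) : Prop :=
  ∀ (Δ : Type) (M : Interp (XInd I V P) C P Δ), M.IsModel K →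
    (M.reduct XInd.ofInd XInd.ofInd_injective).SatCQ φ

/-- An atom read as a positive assertion, with each variable `x` replaced by `a_x`. -/
def Atom.toFact {I V C P : Type} : Atom I V C P → Fact (XInd I V P) C P
  | .conc B t => .conc B (XInd.ofTerm t)
  | .role R s t => .role R (XInd.ofTerm s) (XInd.ofTerm t)

/-- The ABox of a query: all its atoms, with each variable `x` replaced by `a_x`. -/
def CQ.toABox {I V C P : Type} (φ : CQ I V C P) : Set (Assertion (XInd I V P) C P) :=
  {α | ∃ β ∈ φ, α = .pos β.toFact}

/-- The union of the ABoxes of a set of queries. -/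
def queriesABox {I V C P : Type} (Q : Set (CQ I V C P)) : Set (Assertion (XInd I V P) C P) :=
  ⋃ φ ∈ Q, CQ.toABox φ

/-- Rigid consequences of a set of queries: the positive rigid assertions over the names of the
ontology and the individual names of the ABox of some query in the set that are entailed by the
ontology and this ABox. -/
def rigidConsequences {I V C P : Type} (RC : Set C) (RR : Set P) (O : Ontology C P)
    (Q : Set (CQ I V C P)) : Set (Assertion (XInd I V P) C P) :=
  {α | ∃ φ ∈ Q, ∃ β : Fact (XInd I V P) C P, α = .pos β ∧
    β.BuiltFrom (XInd.ofTerm '' CQ.terms φ) (RC ∩ O.conceptNames) (RR ∩ O.roleNames) ∧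
    (KB.mk O (CQ.toABox φ)).EntailsFact β}

/-- Rigid ABox types: sets of rigid assertions over the names of the knowledge base that contain,
for each positive such assertion, exactly one of it and its negation. -/
def IsRigidABoxType {I C P : Type} (RC : Set C) (RR : Set P) (K : TKB I C P)
    (A : Set (Assertion I C P)) : Prop :=
  (∀ α ∈ A, α.fact.BuiltFrom K.inds (RC ∩ K.onto.conceptNames) (RR ∩ K.onto.roleNames)) ∧
  ∀ β : Fact I C P,
    β.BuiltFrom K.inds (RC ∩ K.onto.conceptNames) (RR ∩ K.onto.roleNames) →
      (Assertion.neg β ∈ A ↔ Assertion.pos β ∉ A)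

/-- `S R₁ … R_ℓ` is a path of roles of the ontology such that `∃S⁻ ⊑ ∃R₁`, `∃R₁⁻ ⊑ ∃R₂`, … are
entailed; these are the paths of the unnamed successors that every individual satisfying `∃S` has
below its `S`-successor in the canonical interpretation. -/
def SuccessorPath {C P : Type} (I : Type) (O : Ontology C P) (S : Role P)
    (ρ : List (Role P)) : Prop :=
  ρ.head? = some S ∧ (∀ R ∈ ρ, R.name ∈ O.roleNames) ∧
  ρ.IsChain (fun R R' => O.EntailsSub I (.ex R.inverse) (.ex R'))

/-- The rigid consequences of `∃S(b)`: all rigid assertions `B(a_{bρ})` and `R(a_{bσ}, a_{bσT})` on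
the tree of successors that is enforced by `∃S(b)`, starting with the `S`-successor `a_{bS}` of `b`,
up to depth `d`. -/
def treeABox {I V C P : Type} (RC : Set C) (RR : Set P) (O : Ontology C P) (d : ℕ)
    (S : Role P) (b : Term I V) : Set (Assertion (XInd I V P) C P) :=
  {α | ∃ (σ : List (Role P)) (T : Role P), SuccessorPath I O S (σ ++ [T]) ∧
    (σ ++ [T]).length ≤ d ∧
    ((∃ B : BasicConcept C P, B.BuiltFrom (RC ∩ O.conceptNames) (RR ∩ O.roleNames) ∧
        O.EntailsSub I (.ex T.inverse) B ∧ α = .pos (.conc B ⟨b, σ ++ [T]⟩)) ∨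
     (∃ R : Role P, R.name ∈ RR ∩ O.roleNames ∧
        O.EntailsRI I T R ∧ α = .pos (.role R ⟨b, σ⟩ ⟨b, σ ++ [T]⟩)))}

/-- The maximal number of terms of a conjunctive query occurring in `Φ`. -/
noncomputable def TCQ.maxTerms {I V C P : Type} : TCQ I V C P → ℕ
  | .cq φ => (CQ.terms φ).ncard
  | .not Φ => Φ.maxTerms
  | .and Φ Ψ => max Φ.maxTerms Ψ.maxTerms
  | .next Φ => Φ.maxTerms
  | .previous Φ => Φ.maxTerms
  | .until Φ Ψ => max Φ.maxTerms Ψ.maxTerms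
  | .since Φ Ψ => max Φ.maxTerms Ψ.maxTerms

/-- `ψ` is a rigid witness query for `φ` w.r.t. `O`: it contains only rigid names, it has at most as
many terms as `φ`, and every model of `O` that satisfies `ψ` also satisfies `φ`. -/
def IsRigidWitness {I V C P : Type} (RC : Set C) (RR : Set P) (O : Ontology C P)
    (φ ψ : CQ I V C P) : Prop :=
  CQ.BuiltFrom RC RR ψ ∧ (CQ.terms ψ).ncard ≤ (CQ.terms φ).ncard ∧
  ∀ (Δ : Type) (M : Interp I C P Δ), M.SatOntology O → M.SatCQ ψ → M.SatCQ φ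

/-- The roots `b` of flexible existential assertions `∃S(b)`: the individual names of the knowledge
base and the auxiliary names `a_x` for the variables `x` of the queries of `Φ`. -/
def roots {I V C P : Type} (K : TKB I C P) (Φ : TCQ I V C P) : Set (Term I V) :=
  {t | (∃ a ∈ K.inds, t = .ind a) ∨ (∃ x : V, t = .var x ∧ ∃ φ ∈ Φ.cqs, t ∈ CQ.terms φ)}

/-! ### r-complete tuples -/

section RComplete

variable {I V C P : Type} (RC : Set C) (RR : Set P) (K : TKB I C P) (Φ : TCQ I V C P)
  {k : ℕ} (W : Fin k → Set (CQ I V C P)) (ι : Fin (K.n + 1) → Fin k)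

/-- The ABox consisting of the rigid ABox type, the rigid consequences of `QR`, the ABoxes of the
queries in the world at `i`, and the input ABox at `i`. -/
def baseABox (AR : Set (Assertion I C P)) (QR : Set (CQ I V C P)) (i : Fin (K.n + 1 + k)) :
    Set (Assertion (XInd I V P) C P) :=
  Assertion.map XInd.ofInd '' AR ∪ rigidConsequences RC RR K.onto QR ∪
    queriesABox (worldAt W ι i) ∪ Assertion.map XInd.ofInd '' K.aboxAt k i

/-- The knowledge base with the ABox `baseABox` at `i`. -/
def baseKB (AR : Set (Assertion I C P)) (QR : Set (CQ I V C P)) (i : Fin (K.n + 1 + k)) :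
    KB (XInd I V P) C P :=
  ⟨K.onto, baseABox RC RR K W ι AR QR i⟩

/-- The ABox of the set `RF` of flexible existential assertions, where the pair `(S, b)` stands for
`∃S(b)`. -/
def flexABox (RF : Set (Role P × Term I V)) : Set (Assertion (XInd I V P) C P) :=
  ⋃ q ∈ RF, treeABox RC RR K.onto Φ.maxTerms q.1 q.2

/-- The knowledge base to be considered at `i`: `baseKB` extended by the ABox of `RF`. -/
def localKB (AR : Set (Assertion I C P)) (QR : Set (CQ I V C P)) (RF : Set (Role P × Term I V))
    (i : Fin (K.n + 1 + k)) : KB (XInd I V P) C P :=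
  ⟨K.onto, baseABox RC RR K W ι AR QR i ∪ flexABox RC RR K Φ RF⟩

/-- The tuple `(AR, QR, QRn, RF)` is r-complete w.r.t. the worlds `W` and `ι`. -/
structure IsRComplete (AR : Set (Assertion I C P)) (QR QRn : Set (CQ I V C P))
    (RF : Set (Role P × Term I V)) : Prop where
  rigidType : IsRigidABoxType RC RR K AR
  subQR : QR ⊆ Φ.cqs
  subQRn : QRn ⊆ Φ.cqs
  subRF : ∀ q ∈ RF, q.1.name ∈ K.onto.roleNames \ RR ∧ q.2 ∈ roots K Φ
  consistent : ∀ i, (localKB RC RR K Φ W ι AR QR RF i).Consistent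
  negCQs : ∀ i, ∀ φ ∈ Φ.cqs \ worldAt W ι i, ¬ (localKB RC RR K Φ W ι AR QR RF i).EntailsCQ φ
  posMem : ∀ i, worldAt W ι i ⊆ QR
  negMem : ∀ i, Φ.cqs \ worldAt W ι i ⊆ QRn
  witnesses : ∀ i, ∀ φ ∈ QRn, ∀ ψ : CQ I V C P, IsRigidWitness RC RR K.onto φ ψ →
    ¬ (localKB RC RR K Φ W ι AR QR RF i).EntailsCQ ψ
  flexible : ∀ (S : Role P) (b : Term I V), S.name ∈ K.onto.roleNames \ RR → b ∈ roots K Φ →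
    ((S, b) ∈ RF ↔
      ∃ i, (baseKB RC RR K W ι AR QR i).EntailsFact (.conc (.ex S) (XInd.ofTerm b)))

end RComplete

/-- Standing assumptions on a temporal conjunctive query relative to a temporal knowledge base: its
individual names occur in the ABoxes, its concept and role names occur in the ontology, its
conjunctive queries are connected, and distinct ones have no variable in common. -/
structure TCQ.Admissible {I V C P : Type} (Φ : TCQ I V C P) (K : TKB I C P) : Prop where
  inds : ∀ φ ∈ Φ.cqs, ∀ a : I, Term.ind a ∈ CQ.terms φ → a ∈ K.inds
  names : ∀ φ ∈ Φ.cqs, CQ.BuiltFrom K.onto.conceptNames K.onto.roleNames φ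
  connected : ∀ φ ∈ Φ.cqs, CQ.Connected φ
  disjointVars : ∀ φ ∈ Φ.cqs, ∀ φ' ∈ Φ.cqs, φ ≠ φ' →
    ∀ x : V, Term.var x ∈ CQ.terms φ → Term.var x ∉ CQ.terms φ'

end DLLite

namespace DLLite

variable {I V C P N Δ T : Type}

/-! ### Syntactic consequence -/

/-! Forward, the tuple is read off the interpretations: `AR` collects the rigid assertions true in
them, `QR` the queries of the worlds, `QRn` the queries missing from some world, and `RF` is what
the field `flexible` dictates. Each `J i` must then yield a model of the local knowledge base. An
auxiliary name takes its value from a match of its query, in `J i` if the query belongs to the world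
at `i`, in some `J m` otherwise. The tree names below `b` that start with `S` follow successors in
one `J m` in which `b` has an `S`-successor. Whatever is thereby imported from `J m` is asserted
with rigid names only, so it holds in `J i` too. Values may coincide; `Interp.pullback` enlarges the
domain to restore the unique name assumption.

Backward, the canonical models of the base knowledge bases are built over a common domain
(`amalgam`), which consists of all tree nodes generated at some time. At `i`, a node not generated
by its parent keeps only the rigid consequences of its incoming role and what these imply. Since the
type of a generated node depends only on its incoming role, everything below a generated node is
generated as well. So at `i` a branch is an ungenerated upper part, possibly empty, followed by
generated nodes, and `anchor` sends a node to the place where generation starts. Once anchors are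
mapped correctly into a model of the ontology, all nodes are (`ext_typ`, `ext_edge`).

Suppose a query that must fail at `i` is matched in the amalgam. If some term has a root as anchor,
connectedness keeps all anchors within the depth covered by the ABoxes of `RF`; the match then
transfers to every model of the local knowledge base (`satCQ_of_anchor_le`), against `negCQs`.
Otherwise the match lies inside one tree, and the rigid atoms true of its anchors form a rigid
witness query, entailed at the time that generates the tree (`exists_witness`), against `witnesses`.
-/

@[simp] theorem Role.inverse_inverse (R : Role P) : R.inverse.inverse = R := by
  cases R <;> rfl

@[simp] theorem Role.name_inverse (R : Role P) : R.inverse.name = R.name := by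
  cases R <;> rfl

theorem Interp.mem_role_inverse (M : Interp I C P Δ) (R : Role P) (x y : Δ) :
    (x, y) ∈ M.role R.inverse ↔ (y, x) ∈ M.role R := by
  cases R <;> rfl

/-- Role inclusions derivable from the role inclusions of an ontology. -/
inductive RoleLe (O : Ontology C P) (S : Role P) : Role P → Prop
  | refl : RoleLe O S S
  | step {α : RI P} : α ∈ O.ris → RoleLe O S α.sub → RoleLe O S α.sup
  | stepInv {α : RI P} : α ∈ O.ris → RoleLe O S α.sub.inverse → RoleLe O S α.sup.inverse

namespace RoleLe

variable {O : Ontology C P} {S R R' : Role P}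

theorem trans (h : RoleLe O S R) (h' : RoleLe O R R') : RoleLe O S R' := by
  induction h' with
  | refl => exact h
  | step hα _ ih => exact .step hα ih
  | stepInv hα _ ih => exact .stepInv hα ih

theorem inverse (h : RoleLe O S R) : RoleLe O S.inverse R.inverse := by
  induction h with
  | refl => exact .refl
  | step hα _ ih => exact .stepInv hα ih
  | stepInv hα _ ih =>
    rw [Role.inverse_inverse] at ih ⊢
    exact .step hα ih

theorem sound {M : Interp I C P Δ} (hM : M.SatOntology O) (h : RoleLe O S R) :
    M.role S ⊆ M.role R := by
  induction h with
  | refl => exact subset_rfl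
  | step hα _ ih => exact ih.trans (hM.2 _ hα)
  | stepInv hα _ ih =>
    rintro ⟨x, y⟩ hxy
    have := ih hxy
    rw [M.mem_role_inverse] at this ⊢
    exact hM.2 _ hα this

theorem name_mem (h : RoleLe O S R) (hS : S.name ∈ O.roleNames) : R.name ∈ O.roleNames := by
  induction h with
  | refl => exact hS
  | step hα _ _ => exact Or.inr ⟨_, hα, Or.inr rfl⟩
  | stepInv hα _ _ => exact Or.inr ⟨_, hα, Or.inr (Role.name_inverse _).symm⟩

end RoleLe

/-- Basic concepts derivable from a set of basic concepts by the inclusions of an ontology with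
singleton right-hand sides. -/
inductive Closure (O : Ontology C P) (X : Set (BasicConcept C P)) : BasicConcept C P → Prop
  | base {B : BasicConcept C P} : B ∈ X → Closure O X B
  | ci {α : CI C P} {B : BasicConcept C P} : α ∈ O.cis → (∀ B' ∈ α.lhs, Closure O X B') →
      B ∈ α.rhs → Closure O X B
  | ri {S R : Role P} : Closure O X (.ex S) → RoleLe O S R → Closure O X (.ex R)

namespace Closure

variable {O : Ontology C P} {X Y : Set (BasicConcept C P)} {B : BasicConcept C P}

theorem bind (h : Closure O X B) (hXY : ∀ B ∈ X, Closure O Y B) : Closure O Y B := by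
  induction h with
  | base hB => exact hXY _ hB
  | ci hα _ hB ih => exact .ci hα ih hB
  | ri _ hSR ih => exact .ri ih hSR

theorem mono (h : Closure O X B) (hXY : X ⊆ Y) : Closure O Y B :=
  h.bind fun _ hB => .base (hXY hB)

theorem sound (hO : O.IsHorn) {M : Interp I C P Δ} (hM : M.SatOntology O) {x : Δ}
    (hX : ∀ B ∈ X, x ∈ M.basic B) (h : Closure O X B) : x ∈ M.basic B := by
  induction h with
  | base hB => exact hX _ hB
  | ci hα _ hB ih =>
    obtain ⟨B', hB', hx⟩ := hM.1 _ hα x ih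
    -- The Horn condition leaves one disjunct, so the one true in `M` is the one derived.
    rwa [Finset.card_le_one.1 (hO _ hα) _ hB _ hB']
  | ri _ hSR ih =>
    obtain ⟨y, hy⟩ := ih
    exact ⟨y, hSR.sound hM hy⟩

theorem builtFrom (h : Closure O X B)
    (hX : ∀ B ∈ X, B.BuiltFrom O.conceptNames O.roleNames) :
    B.BuiltFrom O.conceptNames O.roleNames := by
  induction h with
  | base hB => exact hX _ hB
  | @ci α B hα _ hB _ =>
    cases B with
    | atomic A => exact ⟨α, hα, Or.inr hB⟩
    | ex R => exact Or.inl ⟨α, hα, R, rfl, Or.inr hB⟩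
  | ri _ hSR ih => exact hSR.name_mem ih

end Closure

/-! ### Amalgamation of knowledge bases that agree on rigid names -/

/-- The basic concepts that an ABox asserts of an individual name. -/
def seeds (A : Set (Assertion N C P)) (b : N) : Set (BasicConcept C P) :=
  {B | Assertion.pos (.conc B b) ∈ A ∨
    ∃ (R : Role P) (c : N), (Assertion.pos (.role R b c) ∈ A ∧ B = .ex R) ∨
      (Assertion.pos (.role R c b) ∈ A ∧ B = .ex R.inverse)}

/-- The role assertions derivable from an ABox. -/
def RootEdge (O : Ontology C P) (A : Set (Assertion N C P)) (R : Role P) (b c : N) : Prop :=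
  ∃ S : Role P, (Assertion.pos (.role S b c) ∈ A ∧ RoleLe O S R) ∨
    (Assertion.pos (.role S c b) ∈ A ∧ RoleLe O S R.inverse)

theorem seeds_sound {A : Set (Assertion N C P)} {M : Interp N C P Δ} (hM : M.SatABox A) {b : N}
    {B : BasicConcept C P} (hB : B ∈ seeds A b) : M.ind b ∈ M.basic B := by
  rcases hB with h | ⟨R, c, ⟨h, rfl⟩ | ⟨h, rfl⟩⟩
  · exact hM _ h
  · exact ⟨_, hM _ h⟩
  · exact ⟨_, (M.mem_role_inverse _ _ _).2 (hM _ h)⟩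

theorem RootEdge.sound {O : Ontology C P} {A : Set (Assertion N C P)} {M : Interp N C P Δ}
    (hO : M.SatOntology O) (hM : M.SatABox A) {R : Role P} {b c : N} (h : RootEdge O A R b c) :
    (M.ind b, M.ind c) ∈ M.role R := by
  obtain ⟨S, ⟨h, hle⟩ | ⟨h, hle⟩⟩ := h
  · exact hle.sound hO (hM _ h)
  · exact (M.mem_role_inverse _ _ _).1 (hle.sound hO (hM _ h))

theorem RootEdge.symm {O : Ontology C P} {A : Set (Assertion N C P)} {R : Role P} {b c : N}
    (h : RootEdge O A R b c) : RootEdge O A R.inverse c b := by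
  obtain ⟨S, h | h⟩ := h
  · exact ⟨S, Or.inr (by simpa using h)⟩
  · exact ⟨S, Or.inl h⟩

theorem RootEdge.mono {O : Ontology C P} {A : Set (Assertion N C P)} {R R' : Role P} {b c : N}
    (h : RootEdge O A R b c) (hR : RoleLe O R R') : RootEdge O A R' b c := by
  obtain ⟨S, ⟨h, hle⟩ | ⟨h, hle⟩⟩ := h
  · exact ⟨S, Or.inl ⟨h, hle.trans hR⟩⟩
  · exact ⟨S, Or.inr ⟨h, hle.trans hR.inverse⟩⟩

theorem RootEdge.closure {O : Ontology C P} {A : Set (Assertion N C P)} {R : Role P} {b c : N}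
    (h : RootEdge O A R b c) : Closure O (seeds A b) (.ex R) := by
  obtain ⟨S, ⟨h, hle⟩ | ⟨h, hle⟩⟩ := h
  · exact .ri (.base (Or.inr ⟨S, c, Or.inl ⟨h, rfl⟩⟩)) hle
  · refine .ri (.base (Or.inr ⟨S, c, Or.inr ⟨h, rfl⟩⟩)) ?_
    simpa using hle.inverse

/-- The knowledge bases `⟨O, A i⟩` are consistent and derive the same rigid assertions. -/
structure Amalgamable (RC : Set C) (RR : Set P) (O : Ontology C P)
    (A : T → Set (Assertion N C P)) : Prop where
  horn : O.IsHorn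
  agreeConc : ∀ i j b B, B.BuiltFrom RC RR →
    Closure O (seeds (A i) b) B → Closure O (seeds (A j) b) B
  agreeRole : ∀ i j b c R, R.name ∈ RR → RootEdge O (A i) R b c → RootEdge O (A j) R b c
  consistent : ∀ i, (KB.mk O (A i)).Consistent

section Amalgam

variable (RC : Set C) (RR : Set P) (O : Ontology C P) (A : T → Set (Assertion N C P))

/-- The type at `i` of the node that is reached from `b` by the given path, last role first. -/
def typ (i : T) (b : N) : List (Role P) → Set (BasicConcept C P)
  | [] => {B | Closure O (seeds (A i) b) B}
  -- If the parent generates the node at `i`, the node has all consequences of `∃S⁻`. If the node is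
  -- only present because of another time, it has the rigid consequences and their closure, which
  -- may again contain flexible concepts.
  | S :: ρ => {B | (.ex S ∈ typ i b ρ ∧ Closure O {.ex S.inverse} B) ∨
      Closure O {B' | B'.BuiltFrom RC RR ∧ Closure O {.ex S.inverse} B'} B}

/-- The nodes that are generated at some time. -/
def IsNode (b : N) : List (Role P) → Prop
  | [] => True
  | S :: ρ => IsNode b ρ ∧ ∃ j, .ex S ∈ typ RC RR O A j b ρ

/-- The roles at `i` from a node to its `S`-child. -/
def Down (i : T) (b : N) (ρ : List (Role P)) (S R : Role P) : Prop :=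
  (.ex S ∈ typ RC RR O A i b ρ ∧ RoleLe O S R) ∨
    -- The rigid super-roles of `S` persist at times that do not generate the child, and so does
    -- everything above them, flexible roles included.
    ∃ R' : Role P, R'.name ∈ RR ∧ RoleLe O S R' ∧ RoleLe O R' R

/-- The roles at `i` between nodes. -/
inductive Edge (i : T) (R : Role P) : N × List (Role P) → N × List (Role P) → Prop
  | root {b c : N} : RootEdge O (A i) R b c → Edge i R (b, []) (c, [])
  | down {b : N} {ρ : List (Role P)} {S : Role P} :
      Down RC RR O A i b ρ S R → Edge i R (b, ρ) (b, S :: ρ)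
  | up {b : N} {ρ : List (Role P)} {S : Role P} :
      Down RC RR O A i b ρ S R.inverse → Edge i R (b, S :: ρ) (b, ρ)

open Classical in
/-- The closest ancestor of a node that is a root or is not generated by its parent at `i`. -/
noncomputable def anchor (i : T) (b : N) : List (Role P) → List (Role P)
  | [] => []
  | S :: ρ => if .ex S ∈ typ RC RR O A i b ρ then anchor i b ρ else S :: ρ

open Classical in
/-- Some `S`-successor, if there is one. -/
noncomputable def Interp.succ (M : Interp I C P Δ) (S : Role P) (x : Δ) : Δ :=
  if h : ∃ y, (x, y) ∈ M.role S then h.choose else x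

theorem Interp.succ_spec (M : Interp I C P Δ) {S : Role P} {x : Δ} (h : x ∈ M.basic (.ex S)) :
    (x, M.succ S x) ∈ M.role S := by
  have h' : ∃ y, (x, y) ∈ M.role S := h
  rw [Interp.succ, dif_pos h']
  exact h'.choose_spec

open Classical in
/-- The extension of a map on anchors to all nodes. -/
noncomputable def ext (M : Interp I C P Δ) (f : N × List (Role P) → Δ) (i : T) (b : N) :
    List (Role P) → Δ
  | [] => f (b, [])
  | S :: ρ => if .ex S ∈ typ RC RR O A i b ρ then M.succ S (ext M f i b ρ) else f (b, S :: ρ)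

variable {RC RR O A}

theorem Down.mono {i : T} {b : N} {ρ : List (Role P)} {S R R' : Role P}
    (h : Down RC RR O A i b ρ S R) (hR : RoleLe O R R') : Down RC RR O A i b ρ S R' := by
  rcases h with ⟨h1, h2⟩ | ⟨R'', h1, h2, h3⟩
  · exact Or.inl ⟨h1, h2.trans hR⟩
  · exact Or.inr ⟨R'', h1, h2, h3.trans hR⟩

theorem Down.roleLe {i : T} {b : N} {ρ : List (Role P)} {S R : Role P}
    (h : Down RC RR O A i b ρ S R) : RoleLe O S R := by
  rcases h with ⟨_, h2⟩ | ⟨R'', _, h2, h3⟩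
  · exact h2
  · exact h2.trans h3

theorem Edge.symm {i : T} {R : Role P} {x y : N × List (Role P)} (h : Edge RC RR O A i R x y) :
    Edge RC RR O A i R.inverse y x := by
  cases h with
  | root h => exact .root h.symm
  | down h => exact .up (by simpa using h)
  | up h => exact .down h

theorem Edge.mono {i : T} {R R' : Role P} {x y : N × List (Role P)} (h : Edge RC RR O A i R x y)
    (hR : RoleLe O R R') : Edge RC RR O A i R' x y := by
  cases h with
  | root h => exact .root (h.mono hR)
  | down h => exact .down (h.mono hR)
  | up h => exact .up (h.mono hR.inverse)

/-- For a rigid `R`, the detour in `Down` can go through `R` itself. -/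
theorem Edge.rigid (hA : ∀ i j b c R, R.name ∈ RR → RootEdge O (A i) R b c → RootEdge O (A j) R b c)
    {i j : T} {R : Role P} (hR : R.name ∈ RR) {x y : N × List (Role P)}
    (h : Edge RC RR O A i R x y) : Edge RC RR O A j R x y := by
  cases h with
  | root h => exact .root (hA _ _ _ _ _ hR h)
  | down h => exact .down (Or.inr ⟨R, hR, h.roleLe, .refl⟩)
  | up h => exact .up (Or.inr ⟨R.inverse, by simpa using hR, h.roleLe, .refl⟩)

theorem typ_cons_subset {i : T} {b : N} {ρ : List (Role P)} {S : Role P} {B : BasicConcept C P}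
    (h : B ∈ typ RC RR O A i b (S :: ρ)) : Closure O {.ex S.inverse} B := by
  rcases h with h | h
  · exact h.2
  · exact h.bind fun _ hB => hB.2

/-- The two ways into a type never mix: at a generated node the first subsumes the second, at any
other node only the second is available. -/
theorem typ_bind {i : T} {b : N} {ρ : List (Role P)} {B : BasicConcept C P}
    (h : Closure O (typ RC RR O A i b ρ) B) : B ∈ typ RC RR O A i b ρ := by
  cases ρ with
  | nil => exact h.bind fun _ hB => hB
  | cons S ρ =>
    by_cases hS : BasicConcept.ex S ∈ typ RC RR O A i b ρ
    · exact Or.inl ⟨hS, h.bind fun _ hB => typ_cons_subset hB⟩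
    · exact Or.inr (h.bind fun _ hB => hB.resolve_left fun h' => hS h'.1)

/-- The time that generates the node is irrelevant below the first level, because at every time the
type of an `S'`-child lies within the closure of `∃S'⁻`. -/
theorem IsNode.closure {b : N} {ρ : List (Role P)} {S S' : Role P}
    (h : IsNode RC RR O A b (S :: S' :: ρ)) : Closure O {.ex S'.inverse} (.ex S) := by
  obtain ⟨_, j, hj⟩ := h
  exact typ_cons_subset hj

theorem typ_rigid (hA : ∀ i j b B, B.BuiltFrom RC RR →
      Closure O (seeds (A i) b) B → Closure O (seeds (A j) b) B)
    {i j : T} {b : N} {ρ : List (Role P)} {B : BasicConcept C P} (hB : B.BuiltFrom RC RR)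
    (h : B ∈ typ RC RR O A i b ρ) : B ∈ typ RC RR O A j b ρ := by
  cases ρ with
  | nil => exact hA _ _ _ _ hB h
  | cons S ρ => exact Or.inr (.base ⟨hB, typ_cons_subset h⟩)

theorem anchor_eq_nil_of_cons {i : T} {b : N} {ρ : List (Role P)} {S : Role P}
    (h : anchor RC RR O A i b (S :: ρ) = []) :
    .ex S ∈ typ RC RR O A i b ρ ∧ anchor RC RR O A i b ρ = [] := by
  rw [anchor] at h
  split_ifs at h with h'
  exact ⟨h', h⟩

theorem anchor_suffix (i : T) (b : N) (ρ : List (Role P)) : anchor RC RR O A i b ρ <:+ ρ := by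
  induction ρ with
  | nil => simp [anchor]
  | cons S ρ ih =>
    rw [anchor]
    split_ifs
    · exact ih.trans (List.suffix_cons _ _)
    · exact List.suffix_rfl

theorem IsNode.of_suffix {b : N} {ρ σ : List (Role P)} (h : IsNode RC RR O A b ρ)
    (hσ : σ <:+ ρ) : IsNode RC RR O A b σ := by
  induction ρ with
  | nil => rw [List.suffix_nil.1 hσ]; trivial
  | cons S ρ ih =>
    rcases List.suffix_cons_iff.1 hσ with rfl | h'
    · exact h
    · exact ih h.1 h'

/-- If the first role of a path is generated at `i`, then so is the whole path. -/
theorem anchor_eq_nil {i : T} {b : N} {S : Role P} (hS : .ex S ∈ typ RC RR O A i b [])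
    {ρ : List (Role P)} (hρ : IsNode RC RR O A b ρ) (hl : ρ.getLast? = some S) :
    anchor RC RR O A i b ρ = [] := by
  induction ρ with
  | nil => rfl
  | cons S' ρ ih =>
    cases ρ with
    | nil =>
      obtain rfl : S' = S := by simpa using hl
      rw [anchor, if_pos hS, anchor]
    | cons S'' ρ =>
      have h1 := ih hρ.1 (by simpa using hl)
      have h2 := (anchor_eq_nil_of_cons h1).1
      -- The parent is generated at `i`, so it has the full closure of its incoming role, which
      -- contains `∃S'`.
      rw [anchor, if_pos, h1]
      exact Or.inl ⟨h2, hρ.closure⟩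

theorem IsNode.exists_last {b : N} {ρ : List (Role P)} (h : IsNode RC RR O A b ρ) (hρ : ρ ≠ []) :
    ∃ S i, ρ.getLast? = some S ∧ .ex S ∈ typ RC RR O A i b [] := by
  have h1 : [ρ.getLast hρ] <:+ ρ := by
    rw [List.singleton_suffix_iff_getLast?_eq_some, List.getLast?_eq_getLast_of_ne_nil hρ]
  obtain ⟨_, i, hi⟩ := h.of_suffix h1
  exact ⟨_, i, List.getLast?_eq_getLast_of_ne_nil hρ, hi⟩

/-- A child that is not generated by its parent at `i` has a parent of the same kind. -/
theorem IsNode.anchor_parent {i : T} {b : N} {ρ : List (Role P)} {S : Role P}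
    (h : IsNode RC RR O A b (S :: ρ)) (hS : .ex S ∉ typ RC RR O A i b ρ) :
    anchor RC RR O A i b ρ = ρ := by
  cases ρ with
  | nil => rfl
  | cons S' ρ =>
    rw [anchor, if_neg]
    -- A generated parent would have all consequences of its incoming role, among them `∃S`.
    exact fun h' => hS (Or.inl ⟨h', h.closure⟩)

theorem ext_of_anchor_eq (M : Interp I C P Δ) (f : N × List (Role P) → Δ) {i : T} {b : N}
    {ρ : List (Role P)} (h : anchor RC RR O A i b ρ = ρ) : ext RC RR O A M f i b ρ = f (b, ρ) := by
  cases ρ with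
  | nil => rfl
  | cons S ρ =>
    rw [ext, if_neg]
    intro h'
    rw [anchor, if_pos h'] at h
    have := (anchor_suffix (RC := RC) (RR := RR) (O := O) (A := A) i b ρ).length_le
    rw [h] at this
    simp at this

/-! ### Extending maps from anchors to all nodes -/

section Extension

variable {M : Interp I C P Δ} {f : N × List (Role P) → Δ} {i : T} {D : N → List (Role P) → Prop}

/-- `D` delimits the anchors on which `f` is known to be correct. Below an anchor, any successor in
`M` will do as image of a generated child, since the type of the child only contains consequences of
its incoming role. -/
theorem ext_typ (hO : O.IsHorn) (hM : M.SatOntology O)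
    (hf : ∀ b ρ, D b ρ → anchor RC RR O A i b ρ = ρ → ∀ B ∈ typ RC RR O A i b ρ,
      f (b, ρ) ∈ M.basic B)
    {b : N} {ρ : List (Role P)} (hρ : D b (anchor RC RR O A i b ρ)) {B : BasicConcept C P}
    (hB : B ∈ typ RC RR O A i b ρ) : ext RC RR O A M f i b ρ ∈ M.basic B := by
  induction ρ generalizing B with
  | nil => exact hf b [] hρ rfl B hB
  | cons S ρ ih =>
    by_cases hS : BasicConcept.ex S ∈ typ RC RR O A i b ρ
    · rw [anchor, if_pos hS] at hρ
      rw [ext, if_pos hS]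
      have h1 := M.succ_spec (ih hρ hS)
      refine (typ_cons_subset hB).sound hO hM ?_
      rintro _ rfl
      exact ⟨_, (M.mem_role_inverse _ _ _).2 h1⟩
    · have h1 : anchor RC RR O A i b (S :: ρ) = S :: ρ := by rw [anchor, if_neg hS]
      rw [ext_of_anchor_eq M f h1]
      exact hf b _ (h1 ▸ hρ) h1 B hB

/-- An edge to a generated child is realised by the chosen successor. At a child that is not
generated, both ends are their own anchors, and the edge comes from a rigid role; this is why
`hdown` concerns rigid roles only. -/
theorem ext_edge (hO : O.IsHorn) (hM : M.SatOntology O)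
    (hf : ∀ b ρ, D b ρ → anchor RC RR O A i b ρ = ρ → ∀ B ∈ typ RC RR O A i b ρ,
      f (b, ρ) ∈ M.basic B)
    (hroot : ∀ R b c, D b [] → D c [] → RootEdge O (A i) R b c →
      (f (b, []), f (c, [])) ∈ M.role R)
    (hdown : ∀ R S b ρ, D b ρ → D b (S :: ρ) → anchor RC RR O A i b (S :: ρ) = S :: ρ →
      RoleLe O S R → R.name ∈ RR → (f (b, ρ), f (b, S :: ρ)) ∈ M.role R)
    {R : Role P} {x y : N × List (Role P)} (hx : IsNode RC RR O A x.1 x.2)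
    (hy : IsNode RC RR O A y.1 y.2) (hDx : D x.1 (anchor RC RR O A i x.1 x.2))
    (hDy : D y.1 (anchor RC RR O A i y.1 y.2)) (h : Edge RC RR O A i R x y) :
    (ext RC RR O A M f i x.1 x.2, ext RC RR O A M f i y.1 y.2) ∈ M.role R := by
  have key : ∀ (R : Role P) (b : N) (ρ : List (Role P)) (S : Role P),
      IsNode RC RR O A b (S :: ρ) → D b (anchor RC RR O A i b ρ) →
      D b (anchor RC RR O A i b (S :: ρ)) → Down RC RR O A i b ρ S R →
      (ext RC RR O A M f i b ρ, ext RC RR O A M f i b (S :: ρ)) ∈ M.role R := by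
    intro R b ρ S hn h1 h2 h
    by_cases hS : BasicConcept.ex S ∈ typ RC RR O A i b ρ
    · rw [ext, if_pos hS]
      exact h.roleLe.sound hM (M.succ_spec (ext_typ hO hM hf h1 hS))
    · have h3 : anchor RC RR O A i b (S :: ρ) = S :: ρ := by rw [anchor, if_neg hS]
      have h4 := hn.anchor_parent hS
      rw [ext_of_anchor_eq M f h3, ext_of_anchor_eq M f h4]
      obtain ⟨R', hR', h5, h6⟩ := h.resolve_left fun h' => hS h'.1
      exact h6.sound hM (hdown R' S b ρ (h4 ▸ h1) (h3 ▸ h2) h3 h5 hR')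
  cases h with
  | root h => exact hroot _ _ _ hDx hDy h
  | down h => exact key _ _ _ _ hy hDx hDy h
  | up h => exact (M.mem_role_inverse _ _ _).1 (key _ _ _ _ hx hDy hDx h)

end Extension

/-- Every model of the knowledge base at `i` contains the nodes that are generated at `i`. -/
theorem ext_typ_of_model (hO : O.IsHorn) {i : T} {M : Interp N C P Δ} (hM : M.SatOntology O)
    (hMA : M.SatABox (A i)) {b : N} {ρ : List (Role P)} (hρ : anchor RC RR O A i b ρ = [])
    {B : BasicConcept C P} (hB : B ∈ typ RC RR O A i b ρ) :
    ext RC RR O A M (fun x => M.ind x.1) i b ρ ∈ M.basic B := by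
  -- The only anchors are roots, so `f` has to be correct on the names alone.
  refine ext_typ (D := fun _ ρ => ρ = []) hO hM ?_ hρ hB
  rintro b _ rfl _ B hB
  exact Closure.sound hO hM (fun _ h => seeds_sound hMA h) hB

theorem ext_edge_of_model (hO : O.IsHorn) {i : T} {M : Interp N C P Δ} (hM : M.SatOntology O)
    (hMA : M.SatABox (A i)) {R : Role P} {x y : N × List (Role P)}
    (hx : IsNode RC RR O A x.1 x.2) (hy : IsNode RC RR O A y.1 y.2)
    (hDx : anchor RC RR O A i x.1 x.2 = []) (hDy : anchor RC RR O A i y.1 y.2 = [])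
    (h : Edge RC RR O A i R x y) :
    (ext RC RR O A M (fun x => M.ind x.1) i x.1 x.2,
      ext RC RR O A M (fun x => M.ind x.1) i y.1 y.2) ∈ M.role R := by
  refine ext_edge (D := fun _ ρ => ρ = []) hO hM ?_ ?_ ?_ hx hy hDx hDy h
  · rintro b _ rfl _ B hB
    exact Closure.sound hO hM (fun _ h => seeds_sound hMA h) hB
  · exact fun R b c _ _ h => h.sound hM hMA
  · intro R S b ρ _ h
    cases h

variable (RC RR O A) in
/-- The domain of the amalgam. -/
abbrev Node : Type := {x : N × List (Role P) // IsNode RC RR O A x.1 x.2}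

/-- A node that consists of a name. -/
def Node.root (b : N) : Node RC RR O A := ⟨(b, []), trivial⟩

variable (RC RR O A) in
/-- The interpretation at `i` in the amalgam. -/
def amalgam [Nonempty N] (i : T) : Interp N C P (Node RC RR O A) where
  nonempty := ⟨Node.root (Classical.arbitrary N)⟩
  ind := Node.root
  una := fun _ _ h => congrArg (fun x : Node RC RR O A => x.1.1) h
  conc := fun A' => {x | .atomic A' ∈ typ RC RR O A i x.1.1 x.1.2}
  prim := fun p => {q | Edge RC RR O A i (.prim p) q.1.1 q.2.1}

variable [Nonempty N]

theorem amalgam_role {i : T} {R : Role P} {x y : Node RC RR O A} :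
    (x, y) ∈ (amalgam RC RR O A i).role R ↔ Edge RC RR O A i R x.1 y.1 := by
  cases R with
  | prim p => exact Iff.rfl
  | inv p => exact ⟨fun h => Edge.symm h, fun h => Edge.symm h⟩

theorem rootEdge_of_role {i : T} {R : Role P} {a b : N}
    (hR : (amalgam RC RR O A i).SatFact (.role R a b)) : RootEdge O (A i) R a b := by
  have h' : Edge RC RR O A i R (a, []) (b, []) := amalgam_role.1 hR
  cases h' with
  | root h' => exact h'

namespace Amalgamable

variable (h : Amalgamable RC RR O A)
include h

/-- Types and edges are defined independently; this is where they are shown to match. An `R`-edge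
may lead to a root, to a child or to the parent, and in each case `∃R` must already be in the type.
-/
theorem basic_iff {i : T} {B : BasicConcept C P} {x : Node RC RR O A} :
    x ∈ (amalgam RC RR O A i).basic B ↔ B ∈ typ RC RR O A i x.1.1 x.1.2 := by
  cases B with
  | atomic A' => exact Iff.rfl
  | ex R =>
    constructor
    · rintro ⟨⟨y, hy⟩, hxy⟩
      rw [amalgam_role] at hxy
      obtain ⟨x, hx⟩ := x
      dsimp only at hxy ⊢
      cases hxy with
      | root h' => exact h'.closure
      | down h' =>
        rcases h' with ⟨h1, h2⟩ | ⟨R', h1, h2, h3⟩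
        · exact typ_bind (.ri (.base h1) h2)
        -- The child exists because of some time `j`. There `∃R'` is in the type of the parent;
        -- being rigid, it is also there at `i`, where it yields `∃R`.
        · obtain ⟨_, j, hj⟩ := hy
          have h4 := typ_bind (.ri (.base hj) h2)
          exact typ_bind (.ri (.base (typ_rigid h.agreeConc (j := i) h1 h4)) h3)
      | @up b ρ S h' =>
        have key : ∀ R', RoleLe O S R' → Closure O {.ex S.inverse} (.ex R'.inverse) :=
          fun R' h1 => .ri (.base rfl) h1.inverse
        rcases h' with ⟨h1, h2⟩ | ⟨R', h1, h2, h3⟩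
        · exact Or.inl ⟨h1, by simpa using key _ h2⟩
        · refine Or.inr (.ri (S := R'.inverse) (.base ⟨?_, key _ h2⟩) (by simpa using h3.inverse))
          simpa [BasicConcept.BuiltFrom] using h1
    · intro hR
      exact ⟨⟨(x.1.1, R :: x.1.2), x.2, i, hR⟩, amalgam_role.2 (.down (Or.inl ⟨hR, .refl⟩))⟩

theorem satOntology (i : T) : (amalgam RC RR O A i).SatOntology O := by
  refine ⟨fun α hα x hx => ?_, ?_⟩
  · have hx' : ∀ B ∈ α.lhs, B ∈ typ RC RR O A i x.1.1 x.1.2 := fun B hB => h.basic_iff.1 (hx B hB)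
    rcases α.rhs.eq_empty_or_nonempty with he | ⟨B, hB⟩
    -- A violated negative inclusion is moved to a time `j` at which the whole branch is generated
    -- from its root. Types can only grow in this move, and the node then has an image in a model of
    -- the knowledge base at `j`.
    · exfalso
      obtain ⟨j, hj, hj'⟩ : ∃ j, anchor RC RR O A j x.1.1 x.1.2 = [] ∧
          ∀ B ∈ α.lhs, B ∈ typ RC RR O A j x.1.1 x.1.2 := by
        obtain ⟨⟨b, ρ⟩, hn⟩ := x
        cases ρ with
        | nil => exact ⟨i, rfl, hx'⟩
        | cons S ρ =>
          obtain ⟨S', j, h1, h2⟩ := hn.exists_last (by simp)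
          have h3 := anchor_eq_nil h2 hn h1
          exact ⟨j, h3, fun B hB =>
            Or.inl ⟨(anchor_eq_nil_of_cons h3).1, typ_cons_subset (hx' B hB)⟩⟩
      obtain ⟨Δ, M, hM1, hM2⟩ := h.consistent j
      obtain ⟨B, hB, _⟩ := hM1.1 α hα _ fun B hB =>
        ext_typ_of_model (A := A) h.horn hM1 hM2 hj (hj' B hB)
      simp [he] at hB
    · exact ⟨B, hB, h.basic_iff.2 (typ_bind (.ci hα (fun B' hB' => .base (hx' B' hB')) hB))⟩
  · rintro α hα ⟨x, y⟩ hxy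
    rw [amalgam_role] at hxy ⊢
    exact hxy.mono (.step hα .refl)

theorem satFact_pos {i : T} {α : Fact N C P} (hα : .pos α ∈ A i) :
    (amalgam RC RR O A i).SatFact α := by
  cases α with
  | conc B a => exact h.basic_iff.2 (Closure.base (Or.inl hα))
  | role R a b => exact amalgam_role.2 (.root ⟨R, Or.inl ⟨hα, .refl⟩⟩)

theorem satABox (i : T) : (amalgam RC RR O A i).SatABox (A i) := by
  intro α hα
  cases α with
  | pos α => exact h.satFact_pos hα
  | neg α =>
    -- Facts about names in the amalgam are derivable, hence true in every model, and one of these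
    -- also satisfies the negation.
    intro hs
    obtain ⟨Δ, M, hM1, hM2⟩ := h.consistent i
    refine hM2 _ hα ?_
    cases α with
    | conc B a =>
      exact Closure.sound h.horn hM1 (fun _ h => seeds_sound hM2 h) (h.basic_iff.1 hs)
    | role R a b => exact (rootEdge_of_role hs).sound hM1 hM2

theorem basic_rigid {i j : T} {B : BasicConcept C P} (hB : B.BuiltFrom RC RR)
    {x : Node RC RR O A} (hx : x ∈ (amalgam RC RR O A i).basic B) :
    x ∈ (amalgam RC RR O A j).basic B :=
  h.basic_iff.2 (typ_rigid h.agreeConc hB (h.basic_iff.1 hx))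

theorem role_rigid {i j : T} {R : Role P} (hR : R.name ∈ RR)
    {x y : Node RC RR O A} (hx : (x, y) ∈ (amalgam RC RR O A i).role R) :
    (x, y) ∈ (amalgam RC RR O A j).role R :=
  amalgam_role.2 ((amalgam_role.1 hx).rigid h.agreeRole hR)

theorem respectRigid : RespectRigid RC RR (amalgam RC RR O A) := by
  refine fun i j => ⟨rfl, fun A' hA' => ?_, fun p hp => ?_⟩
  · ext x
    exact ⟨h.basic_rigid (B := .atomic A') hA', h.basic_rigid (B := .atomic A') hA'⟩
  · ext ⟨x, y⟩
    exact ⟨h.role_rigid (R := .prim p) hp, h.role_rigid (R := .prim p) hp⟩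

end Amalgamable

end Amalgam

/-- Consistent Horn knowledge bases entail only the basic concept assertions that are derivable. -/
theorem closure_of_entailsFact {O : Ontology C P} (hO : O.IsHorn) {A : Set (Assertion N C P)}
    (hA : (KB.mk O A).Consistent) {B : BasicConcept C P} {b : N}
    (h : (KB.mk O A).EntailsFact (.conc B b)) : Closure O (seeds A b) B := by
  have : Nonempty N := ⟨b⟩
  -- With a single time and no rigid names, the amalgam is the usual canonical model.
  have hA' : Amalgamable (∅ : Set C) (∅ : Set P) O (fun _ : Unit => A) :=
    ⟨hO, fun _ _ _ _ _ h => h, fun _ _ _ _ _ _ h => h, fun _ => hA⟩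
  exact hA'.basic_iff.1 (h _ _ ⟨hA'.satOntology (), hA'.satABox ()⟩)

/-! ### Queries -/

theorem CQ.finite_terms (φ : CQ I V C P) : (CQ.terms φ).Finite := by
  have : CQ.terms φ = ⋃ α ∈ (φ : Set (Atom I V C P)), α.terms := by
    ext t
    simp [CQ.terms]
  rw [this]
  refine φ.finite_toSet.biUnion fun α _ => ?_
  cases α with
  | conc B t => exact Set.finite_singleton _
  | role R s t => exact (Set.finite_singleton t).insert s

theorem TCQ.ncard_terms_le {Φ : TCQ I V C P} {φ : CQ I V C P} (hφ : φ ∈ Φ.cqs) :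
    (CQ.terms φ).ncard ≤ Φ.maxTerms := by
  induction Φ with
  | cq ψ =>
    rw [Set.mem_singleton_iff.1 hφ]
    exact le_rfl
  | not Φ ih | next Φ ih | previous Φ ih => exact ih hφ
  | _ Φ Ψ ih ih' =>
    rcases hφ with hφ | hφ
    · exact (ih hφ).trans (le_max_left _ _)
    · exact (ih' hφ).trans (le_max_right _ _)

theorem Atom.toFact_builtFrom {φ : CQ I V C P} {α : Atom I V C P} (hα : α ∈ φ) {SC : Set C}
    {SP : Set P} (h : CQ.BuiltFrom SC SP φ) :
    α.toFact.BuiltFrom (XInd.ofTerm '' CQ.terms φ) SC SP := by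
  have h' := h α hα
  cases α with
  | conc B t => exact ⟨h', t, ⟨_, hα, rfl⟩, rfl⟩
  | role R s t => exact ⟨h', ⟨s, ⟨_, hα, Or.inl rfl⟩, rfl⟩, t, ⟨_, hα, Or.inr rfl⟩, rfl⟩

theorem XInd.ofTerm_injective : Function.Injective (XInd.ofTerm : Term I V → XInd I V P) :=
  fun _ _ h => congrArg XInd.root h

theorem BasicConcept.BuiltFrom.inter {SC SC' : Set C} {SP SP' : Set P} {B : BasicConcept C P}
    (h : B.BuiltFrom SC SP) (h' : B.BuiltFrom SC' SP') :
    B.BuiltFrom (SC ∩ SC') (SP ∩ SP') := by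
  cases B with
  | atomic A => exact ⟨h, h'⟩
  | ex R => exact ⟨h, h'⟩

theorem TKB.exists_of_mem_aboxAt {K : TKB I C P} {k : ℕ} {i : Fin (K.n + 1 + k)}
    {α : Assertion I C P} (h : α ∈ K.aboxAt k i) : ∃ j, α ∈ K.abox j := by
  induction i using Fin.addCases with
  | left i => exact ⟨i, by simpa [TKB.aboxAt] using h⟩
  | right i => simp [TKB.aboxAt] at h

theorem TKB.fact_builtFrom_of_mem_aboxAt {K : TKB I C P} (hK : K.NamesInOntology) {k : ℕ}
    {i : Fin (K.n + 1 + k)} {α : Assertion I C P} (h : α ∈ K.aboxAt k i) :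
    α.fact.BuiltFrom K.inds K.onto.conceptNames K.onto.roleNames := by
  obtain ⟨j, hj⟩ := TKB.exists_of_mem_aboxAt h
  have h1 := hK j α hj
  have h2 : ∀ a ∈ α.fact.inds, a ∈ K.inds := fun a ha => ⟨j, α, hj, ha⟩
  generalize α.fact = β at h1 h2
  cases β with
  | conc B a => exact ⟨h1.1, h2 a rfl⟩
  | role R a b => exact ⟨h1.1, h2 a (Or.inl rfl), h2 b (Or.inr rfl)⟩

theorem Fact.BuiltFrom.of_inter {α : Fact N C P} {SI : Set N} {SC SC' : Set C} {SP SP' : Set P}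
    (h : α.BuiltFrom SI (SC ∩ SC') (SP ∩ SP')) : α.BuiltFrom SI SC' SP' := by
  rcases α with ⟨_ | _, a⟩ | ⟨R, a, b⟩
  · exact ⟨h.1.2, h.2⟩
  · exact ⟨h.1.2, h.2⟩
  · exact ⟨h.1.2, h.2⟩

/-! ### The base ABoxes -/

section Base

variable {RC : Set C} {RR : Set P} {K : TKB I C P} {Φ : TCQ I V C P} {k : ℕ}
  {W : Fin k → Set (CQ I V C P)} {ι : Fin (K.n + 1) → Fin k} {AR : Set (Assertion I C P)}
  {QR : Set (CQ I V C P)}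

/-- Each positive assertion concerns only original names or is entailed by the ABox of a single
query. The separation is what makes rigid consequences, computed query by query, sufficient. -/
theorem base_cases (hK : K.NamesInOntology) (hΦ : Φ.Admissible K)
    (hAR : IsRigidABoxType RC RR K AR) (hQR : QR ⊆ Φ.cqs) {i : Fin (K.n + 1 + k)}
    (hWQ : worldAt W ι i ⊆ QR) {α : Fact (XInd I V P) C P}
    (hα : .pos α ∈ baseABox RC RR K W ι AR QR i) :
    (∃ β : Fact I C P, α = β.map XInd.ofInd ∧
      β.BuiltFrom K.inds K.onto.conceptNames K.onto.roleNames) ∨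
    ∃ φ ∈ QR, α.BuiltFrom (XInd.ofTerm '' CQ.terms φ) K.onto.conceptNames K.onto.roleNames ∧
      (KB.mk K.onto (CQ.toABox φ)).EntailsFact α := by
  rcases hα with ((⟨β, hβ, hα⟩ | hα) | hα) | ⟨β, hβ, hα⟩
  · rcases β with β | β
    · exact Or.inl ⟨β, (Assertion.pos.inj hα).symm, (hAR.1 _ hβ).of_inter⟩
    · exact absurd hα (by simp [Assertion.map])
  · obtain ⟨φ, hφ, β, hβ, h1, h2⟩ := hα
    obtain rfl := Assertion.pos.inj hβ
    exact Or.inr ⟨φ, hφ, h1.of_inter, h2⟩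
  · simp only [queriesABox, Set.mem_iUnion] at hα
    obtain ⟨φ, hφ, β, hβ, hα⟩ := hα
    obtain rfl := Assertion.pos.inj hα
    exact Or.inr ⟨φ, hWQ hφ, Atom.toFact_builtFrom hβ (hΦ.names φ (hQR (hWQ hφ))),
      fun _ M hM => hM.2 _ ⟨β, hβ, rfl⟩⟩
  · rcases β with β | β
    · exact Or.inl ⟨β, (Assertion.pos.inj hα).symm, TKB.fact_builtFrom_of_mem_aboxAt hK hβ⟩
    · exact absurd hα (by simp [Assertion.map])

theorem seeds_base (hK : K.NamesInOntology) (hΦ : Φ.Admissible K)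
    (hAR : IsRigidABoxType RC RR K AR) (hQR : QR ⊆ Φ.cqs) {i : Fin (K.n + 1 + k)}
    (hWQ : worldAt W ι i ⊆ QR) {B : BasicConcept C P} {b : XInd I V P}
    (hB : B ∈ seeds (baseABox RC RR K W ι AR QR i) b) :
    B.BuiltFrom K.onto.conceptNames K.onto.roleNames ∧
    ((∃ a ∈ K.inds, b = XInd.ofInd a) ∨ ∃ φ ∈ QR, ∃ t ∈ CQ.terms φ, b = XInd.ofTerm t ∧
      (KB.mk K.onto (CQ.toABox φ)).EntailsFact (.conc B b)) := by
  rcases hB with h | ⟨R, c, ⟨h, rfl⟩ | ⟨h, rfl⟩⟩ <;>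
  rcases base_cases hK hΦ hAR hQR hWQ h with ⟨β, hβ, h1⟩ | ⟨φ, hφ, h1, h2⟩
  · rcases β with ⟨B, a⟩ | ⟨R, a, a'⟩
    · obtain ⟨rfl, rfl⟩ := Fact.conc.inj hβ
      exact ⟨h1.1, Or.inl ⟨a, h1.2, rfl⟩⟩
    · cases hβ
  · obtain ⟨t, ht, rfl⟩ := h1.2
    exact ⟨h1.1, Or.inr ⟨φ, hφ, t, ht, rfl, h2⟩⟩
  · rcases β with ⟨B, a⟩ | ⟨R, a, a'⟩
    · cases hβ
    · obtain ⟨rfl, rfl, rfl⟩ := Fact.role.inj hβ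
      exact ⟨h1.1, Or.inl ⟨a, h1.2.1, rfl⟩⟩
  · obtain ⟨t, ht, rfl⟩ := h1.2.1
    exact ⟨h1.1, Or.inr ⟨φ, hφ, t, ht, rfl, fun _ M hM => ⟨_, h2 _ M hM⟩⟩⟩
  · rcases β with ⟨B, a⟩ | ⟨R, a, a'⟩
    · cases hβ
    · obtain ⟨rfl, rfl, rfl⟩ := Fact.role.inj hβ
      exact ⟨by simpa [BasicConcept.BuiltFrom] using h1.1, Or.inl ⟨a', h1.2.2, rfl⟩⟩
  · obtain ⟨t, ht, rfl⟩ := h1.2.2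
    exact ⟨by simpa [BasicConcept.BuiltFrom] using h1.1, Or.inr ⟨φ, hφ, t, ht, rfl,
      fun _ M hM => ⟨_, (M.mem_role_inverse _ _ _).2 (h2 _ M hM)⟩⟩⟩

theorem closure_base_builtFrom (hK : K.NamesInOntology) (hΦ : Φ.Admissible K)
    (hAR : IsRigidABoxType RC RR K AR) (hQR : QR ⊆ Φ.cqs) {i : Fin (K.n + 1 + k)}
    (hWQ : worldAt W ι i ⊆ QR) {B : BasicConcept C P} {b : XInd I V P}
    (hB : Closure K.onto (seeds (baseABox RC RR K W ι AR QR i) b) B) :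
    B.BuiltFrom K.onto.conceptNames K.onto.roleNames :=
  hB.builtFrom fun _ h => (seeds_base hK hΦ hAR hQR hWQ h).1

/-- The type of an auxiliary name is determined by the query to which its variable belongs. -/
theorem closure_base_cases (hO : K.onto.IsHorn) (hK : K.NamesInOntology) (hΦ : Φ.Admissible K)
    (hAR : IsRigidABoxType RC RR K AR) (hQR : QR ⊆ Φ.cqs) {i : Fin (K.n + 1 + k)}
    (hWQ : worldAt W ι i ⊆ QR) {B : BasicConcept C P} {b : XInd I V P}
    (hb : ¬ ∃ a ∈ K.inds, b = XInd.ofInd a)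
    (hB : Closure K.onto (seeds (baseABox RC RR K W ι AR QR i) b) B) :
    Closure K.onto ∅ B ∨ ∃ φ ∈ QR, ∃ t ∈ CQ.terms φ, b = XInd.ofTerm t ∧
      (KB.mk K.onto (CQ.toABox φ)).EntailsFact (.conc B b) := by
  by_cases h : ∃ φ ∈ QR, ∃ t ∈ CQ.terms φ, b = XInd.ofTerm t
  · obtain ⟨φ, hφ, t, ht, rfl⟩ := h
    refine Or.inr ⟨φ, hφ, t, ht, rfl, fun _ M hM => hB.sound hO hM.1 fun B' hB' => ?_⟩
    obtain ⟨φ', hφ', t', ht', htt, h'⟩ :=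
      (seeds_base hK hΦ hAR hQR hWQ hB').2.resolve_left hb
    obtain rfl := XInd.ofTerm_injective htt
    cases t with
    | ind a => exact absurd ⟨a, hΦ.inds φ (hQR hφ) a ht, rfl⟩ hb
    -- Queries that share a variable are equal, so all seeds of `b` stem from the same query.
    | var x =>
      have : φ' = φ := by
        by_contra hne
        exact hΦ.disjointVars _ (hQR hφ') _ (hQR hφ) hne x ht' ht
      subst this
      exact h' _ M hM
  -- No assertion mentions `b`; its type comes only from inclusions with empty left-hand side.
  · refine Or.inl (hB.mono fun B' hB' => h ?_)
    obtain ⟨φ', hφ', t', ht', htt, h'⟩ :=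
      (seeds_base hK hΦ hAR hQR hWQ hB').2.resolve_left hb
    exact ⟨φ', hφ', t', ht', htt⟩

theorem rootEdge_base (hK : K.NamesInOntology) (hΦ : Φ.Admissible K)
    (hAR : IsRigidABoxType RC RR K AR) (hQR : QR ⊆ Φ.cqs) {i : Fin (K.n + 1 + k)}
    (hWQ : worldAt W ι i ⊆ QR) {R : Role P} {b c : XInd I V P}
    (hB : RootEdge K.onto (baseABox RC RR K W ι AR QR i) R b c) :
    R.name ∈ K.onto.roleNames ∧
    ((∃ a ∈ K.inds, ∃ a' ∈ K.inds, b = XInd.ofInd a ∧ c = XInd.ofInd a') ∨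
      ∃ φ ∈ QR, b ∈ XInd.ofTerm '' CQ.terms φ ∧ c ∈ XInd.ofTerm '' CQ.terms φ ∧
      (KB.mk K.onto (CQ.toABox φ)).EntailsFact (.role R b c)) := by
  have key : ∀ (S R : Role P) (b c : XInd I V P),
      .pos (.role S b c) ∈ baseABox RC RR K W ι AR QR i → RoleLe K.onto S R →
      R.name ∈ K.onto.roleNames ∧
      ((∃ a ∈ K.inds, ∃ a' ∈ K.inds, b = XInd.ofInd a ∧ c = XInd.ofInd a') ∨
        ∃ φ ∈ QR, b ∈ XInd.ofTerm '' CQ.terms φ ∧ c ∈ XInd.ofTerm '' CQ.terms φ ∧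
        (KB.mk K.onto (CQ.toABox φ)).EntailsFact (.role R b c)) := by
    intro S R b c h hle
    rcases base_cases hK hΦ hAR hQR hWQ h with ⟨β, hβ, h1⟩ | ⟨φ, hφ, h1, h2⟩
    · rcases β with ⟨B, a⟩ | ⟨R, a, a'⟩
      · cases hβ
      · obtain ⟨rfl, rfl, rfl⟩ := Fact.role.inj hβ
        exact ⟨hle.name_mem h1.1, Or.inl ⟨a, h1.2.1, a', h1.2.2, rfl, rfl⟩⟩
    · exact ⟨hle.name_mem h1.1, Or.inr ⟨φ, hφ, h1.2.1, h1.2.2,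
        fun _ M hM => hle.sound hM.1 (h2 _ M hM)⟩⟩
  obtain ⟨S, ⟨h, hle⟩ | ⟨h, hle⟩⟩ := hB
  · exact key S R b c h hle
  · obtain ⟨h1, h2⟩ := key S _ c b h hle
    refine ⟨by simpa using h1, ?_⟩
    rcases h2 with ⟨a, ha, a', ha', rfl, rfl⟩ | ⟨φ, hφ, hc, hb, h2⟩
    · exact Or.inl ⟨a', ha', a, ha, rfl, rfl⟩
    · exact Or.inr ⟨φ, hφ, hb, hc, fun _ M hM => (M.mem_role_inverse _ _ _).1 (h2 _ M hM)⟩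

/-- Otherwise the ABox type would contain the negation, which `M` refutes. -/
theorem IsRigidABoxType.mem_of_satFact (hAR : IsRigidABoxType RC RR K AR)
    {i : Fin (K.n + 1 + k)} {M : Interp (XInd I V P) C P Δ}
    (hM : M.SatABox (baseABox RC RR K W ι AR QR i)) {β : Fact I C P}
    (hβ : β.BuiltFrom K.inds (RC ∩ K.onto.conceptNames) (RR ∩ K.onto.roleNames))
    (hs : M.SatFact (β.map XInd.ofInd)) : .pos β ∈ AR := by
  by_contra h
  exact hM _ (Or.inl (Or.inl (Or.inl ⟨_, (hAR.2 β hβ).2 h, rfl⟩))) hs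

/-- A derivable rigid assertion on original names is decided by `AR`. One on auxiliary names follows
from a single query and is thus among the rigid consequences of `QR`. Both sets are shared by all
times. -/
theorem amalgamable_base (hO : K.onto.IsHorn) (hK : K.NamesInOntology) (hΦ : Φ.Admissible K)
    (hAR : IsRigidABoxType RC RR K AR) (hQR : QR ⊆ Φ.cqs) (hWQ : ∀ i, worldAt W ι i ⊆ QR)
    (hc : ∀ i, (baseKB RC RR K W ι AR QR i).Consistent) :
    Amalgamable RC RR K.onto (baseABox RC RR K W ι AR QR) := by
  refine ⟨hO, ?_, ?_, hc⟩
  · intro i j b B hB h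
    have hB' := hB.inter (closure_base_builtFrom hK hΦ hAR hQR (hWQ i) h)
    by_cases hb : ∃ a ∈ K.inds, b = XInd.ofInd a
    · obtain ⟨a, ha, rfl⟩ := hb
      obtain ⟨Δ, M, hM⟩ := hc i
      have := hAR.mem_of_satFact hM.2 (β := .conc B a) ⟨hB', ha⟩
        (h.sound hO hM.1 fun _ h => seeds_sound hM.2 h)
      exact .base (Or.inl (Or.inl (Or.inl (Or.inl ⟨_, this, rfl⟩))))
    · rcases closure_base_cases hO hK hΦ hAR hQR (hWQ i) hb h with h' | ⟨φ, hφ, t, ht, rfl, h'⟩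
      · exact h'.mono (Set.empty_subset _)
      · exact .base (Or.inl (Or.inl (Or.inl (Or.inr ⟨φ, hφ, _, rfl, ⟨hB', t, ht, rfl⟩, h'⟩))))
  · intro i j b c R hR h
    obtain ⟨h1, ⟨a, ha, a', ha', rfl, rfl⟩ | ⟨φ, hφ, hb, hc', h'⟩⟩ :=
      rootEdge_base hK hΦ hAR hQR (hWQ i) h
    · obtain ⟨Δ, M, hM⟩ := hc i
      have := hAR.mem_of_satFact hM.2 (β := .role R a a') ⟨⟨hR, h1⟩, ha, ha'⟩ (h.sound hM.1 hM.2)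
      exact ⟨R, Or.inl ⟨Or.inl (Or.inl (Or.inl ⟨_, this, rfl⟩)), .refl⟩⟩
    · exact ⟨R, Or.inl ⟨Or.inl (Or.inl (Or.inr ⟨φ, hφ, _, rfl, ⟨⟨hR, h1⟩, hb, hc'⟩, h'⟩)), .refl⟩⟩

end Base

/-! ### Interpretations with prescribed values of names -/

theorem Interp.reduct_role {I' : Type} (M : Interp I' C P Δ) {f : I → I'}
    (hf : Function.Injective f) (R : Role P) : (M.reduct f hf).role R = M.role R := by
  cases R <;> rfl

theorem Interp.reduct_basic {I' : Type} (M : Interp I' C P Δ) {f : I → I'}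
    (hf : Function.Injective f) (B : BasicConcept C P) :
    (M.reduct f hf).basic B = M.basic B := by
  cases B with
  | atomic A => rfl
  | ex R => simp [Interp.basic, M.reduct_role]

theorem Interp.reduct_satAtom {I' : Type} (M : Interp I' C P Δ) {f : I → I'}
    (hf : Function.Injective f) (π : Term I V → Δ) (α : Atom I V C P) :
    (M.reduct f hf).SatAtom π α ↔ (match α with
      | .conc B t => π t ∈ M.basic B
      | .role R s t => (π s, π t) ∈ M.role R) := by
  cases α with
  | conc B t => rw [Interp.SatAtom, M.reduct_basic]
  | role R s t => rw [Interp.SatAtom, M.reduct_role]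

theorem Interp.SatAtom.congr {M : Interp I C P Δ} {π π' : Term I V → Δ} {α : Atom I V C P}
    (h : M.SatAtom π α) (hπ : ∀ t ∈ α.terms, π t = π' t) : M.SatAtom π' α := by
  cases α with
  | conc B t =>
    rw [Interp.SatAtom, ← hπ t rfl]
    exact h
  | role R s t =>
    rw [Interp.SatAtom, ← hπ s (Or.inl rfl), ← hπ t (Or.inr rfl)]
    exact h

/-- The interpretation with the extensions of `M` in which the name `a` denotes a copy of `g a`. -/
def Interp.pullback [Nonempty N] (M : Interp I C P Δ) (g : N → Δ) : Interp N C P (Δ × N) where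
  nonempty := ⟨(M.nonempty.some, Classical.arbitrary N)⟩
  -- The second component only keeps names apart that `g` identifies; concepts and roles ignore it.
  ind := fun a => (g a, a)
  una := fun _ _ h => congrArg Prod.snd h
  conc := fun A => {x | x.1 ∈ M.conc A}
  prim := fun p => {q | (q.1.1, q.2.1) ∈ M.prim p}

instance [Nonempty I] : Nonempty (XInd I V P) := ⟨XInd.ofInd (Classical.arbitrary I)⟩

section Pullback

variable [Nonempty N] {M : Interp I C P Δ} {g : N → Δ}

theorem Interp.mem_pullback_role {R : Role P} {x y : Δ × N} :
    (x, y) ∈ (M.pullback g).role R ↔ (x.1, y.1) ∈ M.role R := by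
  cases R <;> rfl

theorem Interp.mem_pullback_basic {B : BasicConcept C P} {x : Δ × N} :
    x ∈ (M.pullback g).basic B ↔ x.1 ∈ M.basic B := by
  cases B with
  | atomic A => rfl
  | ex R =>
    exact ⟨fun ⟨y, hy⟩ => ⟨y.1, mem_pullback_role.1 hy⟩,
      fun ⟨y, hy⟩ => ⟨(y, x.2), mem_pullback_role.2 hy⟩⟩

theorem Interp.SatOntology.pullback {O : Ontology C P} (h : M.SatOntology O) :
    (M.pullback g).SatOntology O := by
  refine ⟨fun α hα x hx => ?_, fun α hα ⟨x, y⟩ hxy => ?_⟩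
  · obtain ⟨B, hB, hx'⟩ := h.1 α hα x.1 fun B hB => mem_pullback_basic.1 (hx B hB)
    exact ⟨B, hB, mem_pullback_basic.2 hx'⟩
  · exact mem_pullback_role.2 (h.2 α hα (mem_pullback_role.1 hxy))

theorem Interp.pullback_satFact {f : I → N} (hf : ∀ a, g (f a) = M.ind a) {α : Fact I C P} :
    (M.pullback g).SatFact (α.map f) ↔ M.SatFact α := by
  cases α with
  | conc B a =>
    refine mem_pullback_basic.trans ?_
    rw [Interp.SatFact, ← hf]
    rfl
  | role R a b =>
    refine mem_pullback_role.trans ?_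
    rw [Interp.SatFact, ← hf, ← hf]
    rfl

theorem Interp.pullback_satAssertion {f : I → N} (hf : ∀ a, g (f a) = M.ind a)
    {α : Assertion I C P} : (M.pullback g).SatAssertion (α.map f) ↔ M.SatAssertion α := by
  cases α with
  | pos α => exact pullback_satFact hf
  | neg α => exact not_congr (pullback_satFact hf)

theorem Interp.satCQ_of_pullback {f : I → N} (hf : Function.Injective f)
    (hg : ∀ a, g (f a) = M.ind a) {φ : CQ I V C P}
    (h : ((M.pullback g).reduct f hf).SatCQ φ) : M.SatCQ φ := by
  obtain ⟨π, h1, h2⟩ := h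
  refine ⟨fun t => (π t).1, fun a => ?_, fun α hα => ?_⟩
  · rw [← hg]
    exact congrArg Prod.fst (h1 a)
  have := (Interp.reduct_satAtom _ _ _ _).1 (h2 α hα)
  cases α with
  | conc B t => exact mem_pullback_basic.1 this
  | role R s t => exact mem_pullback_role.1 this

end Pullback

theorem RespectRigid.role_eq {RC : Set C} {RR : Set P} {J : T → Interp I C P Δ}
    (h : RespectRigid RC RR J) {R : Role P} (hR : R.name ∈ RR) (i j : T) :
    (J i).role R = (J j).role R := by
  cases R with
  | prim p => exact (h i j).2.2 p hR
  | inv p =>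
    have := (h i j).2.2 p hR
    simp [Interp.role, this]

theorem RespectRigid.basic_eq {RC : Set C} {RR : Set P} {J : T → Interp I C P Δ}
    (h : RespectRigid RC RR J) {B : BasicConcept C P} (hB : B.BuiltFrom RC RR) (i j : T) :
    (J i).basic B = (J j).basic B := by
  cases B with
  | atomic A => exact (h i j).2.1 A hB
  | ex R => simp [Interp.basic, h.role_eq hB i j]

/-- Values for tree names, such that the tree names below `b` that start with `S` denote the
successors of `b` in an interpretation in which `b` has an `S`-successor. -/
theorem exists_tree_values (J : T → Interp I C P Δ) (i : T) (g : Term I V → Δ) :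
    ∃ G : XInd I V P → Δ, (∀ t, G (XInd.ofTerm t) = g t) ∧
      ∀ b S, (∃ m, g b ∈ (J m).basic (.ex S)) → ∃ m, g b ∈ (J m).basic (.ex S) ∧
        ∀ σ U, (σ ++ [U]).head? = some S → G ⟨b, σ ++ [U]⟩ = (J m).succ U (G ⟨b, σ⟩) := by
  classical
  -- The time depends on `b` and on the first role only, so that a whole tree is evaluated in one
  -- interpretation.
  let m : Term I V → Role P → T := fun b S =>
    if h : ∃ m, g b ∈ (J m).basic (.ex S) then h.choose else i
  let G : XInd I V P → Δ := fun x => match x.path.head? with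
    | none => g x.root
    | some S => x.path.foldl (fun y U => (J (m x.root S)).succ U y) (g x.root)
  refine ⟨G, fun t => rfl, fun b S h => ⟨m b S, ?_, fun σ U hS => ?_⟩⟩
  · simp only [m, dif_pos h]
    exact h.choose_spec
  · cases σ with
    | nil =>
      obtain rfl : U = S := by simpa using hS
      rfl
    | cons S' σ =>
      obtain rfl : S' = S := by simpa using hS
      simp [G]

/-- The entailments along the path are used in `J m`, where `b` has an `S`-successor; the assertions
obtained are rigid and carry over to `J i`. -/
theorem treeABox_sat {RC : Set C} {RR : Set P} {O : Ontology C P} {d : ℕ} {J : T → Interp I C P Δ}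
    (hJ : RespectRigid RC RR J) {m : T} (hO : (J m).SatOntology O) {G : XInd I V P → Δ}
    {b : Term I V} {S : Role P} (hS : G (XInd.ofTerm b) ∈ (J m).basic (.ex S))
    (hG : ∀ σ U, (σ ++ [U]).head? = some S → G ⟨b, σ ++ [U]⟩ = (J m).succ U (G ⟨b, σ⟩)) (i : T)
    [Nonempty (XInd I V P)] :
    ((J i).pullback G).SatABox (treeABox RC RR O d S b) := by
  have key : ∀ σ U, SuccessorPath I O S (σ ++ [U]) → G ⟨b, σ⟩ ∈ (J m).basic (.ex U) := by
    intro σ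
    induction σ using List.reverseRecOn with
    | nil =>
      rintro U ⟨h1, _⟩
      obtain rfl : U = S := by simpa using h1
      exact hS
    | append_singleton σ U' ih =>
      rintro U ⟨h1, h2, h3⟩
      have h1' : (σ ++ [U']).head? = some S := by
        cases σ <;> simpa using h1
      have h3' := List.isChain_append.1 h3
      have h4 := ih U' ⟨h1', fun R hR => h2 R (List.mem_append_left _ hR), h3'.1⟩
      have h5 := (J m).succ_spec h4
      rw [← hG σ U' h1'] at h5
      refine h3'.2.2 U' (by simp) U (by simp) _ _ hO ?_
      exact ⟨_, ((J m).mem_role_inverse _ _ _).2 h5⟩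
  rintro α ⟨σ, U, hp, -, h⟩
  have h1 := (J m).succ_spec (key σ U hp)
  rw [← hG σ U hp.1] at h1
  rcases h with ⟨B, hB, hBO, rfl⟩ | ⟨R, hR, hRO, rfl⟩
  · refine Interp.mem_pullback_basic.2 ?_
    have hB' : B.BuiltFrom RC RR := by
      cases B with
      | atomic A => exact hB.1
      | ex R => exact hB.1
    rw [hJ.basic_eq hB' i m]
    exact hBO _ _ hO ⟨_, ((J m).mem_role_inverse _ _ _).2 h1⟩
  · refine Interp.mem_pullback_role.2 ?_
    rw [hJ.role_eq hR.1 i m]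
    exact hRO _ _ hO h1

/-- The queries that hold at some time can be matched at all times, either in the current
interpretation or in another one. -/
theorem exists_root_values {J : T → Interp I C P Δ} (hJ : ∀ i j, (J i).ind = (J j).ind)
    {w : T → Set (CQ I V C P)} (hw : ∀ i, ∀ φ ∈ w i, (J i).SatCQ φ)
    {Q : Set (CQ I V C P)}
    (hdisj : ∀ φ ∈ Q, ∀ φ' ∈ Q, φ ≠ φ' →
      ∀ x : V, Term.var x ∈ CQ.terms φ → Term.var x ∉ CQ.terms φ')
    (hQ : ∀ φ ∈ Q, ∃ i, φ ∈ w i) (i : T) :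
    ∃ g : Term I V → Δ, (∀ a, g (.ind a) = (J i).ind a) ∧
      ∀ φ ∈ Q, ∃ m, (φ ∈ w i → m = i) ∧ ∀ α ∈ φ, (J m).SatAtom g α := by
  classical
  have h1 : ∀ φ : CQ I V C P, ∃ (m : T) (π : Term I V → Δ), φ ∈ Q → (φ ∈ w i → m = i) ∧
      (∀ a, π (.ind a) = (J i).ind a) ∧ ∀ α ∈ φ, (J m).SatAtom π α := by
    intro φ
    by_cases hi : φ ∈ w i
    · obtain ⟨π, h⟩ := hw i φ hi
      exact ⟨i, π, fun _ => ⟨fun _ => rfl, h⟩⟩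
    by_cases hφ : φ ∈ Q
    · obtain ⟨m, hm⟩ := hQ φ hφ
      obtain ⟨π, h, h'⟩ := hw m φ hm
      exact ⟨m, π, fun _ => ⟨fun h => absurd h hi, fun a => by rw [h, hJ m i], h'⟩⟩
    · exact ⟨i, fun _ => (J i).nonempty.some, fun h => absurd h hφ⟩
  choose m π h1 using h1
  let g : Term I V → Δ := fun t => match t with
    | .ind a => (J i).ind a
    | .var x => if h : ∃ φ ∈ Q, Term.var x ∈ CQ.terms φ then π h.choose (.var x)
        else (J i).nonempty.some
  refine ⟨g, fun a => rfl, fun φ hφ => ⟨m φ, (h1 φ hφ).1, fun α hα => ?_⟩⟩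
  refine ((h1 φ hφ).2.2 α hα).congr fun t ht => ?_
  cases t with
  | ind a => exact (h1 φ hφ).2.1 a
  | var x =>
    have hx : Term.var x ∈ CQ.terms φ := ⟨α, hα, ht⟩
    have h : ∃ φ ∈ Q, Term.var x ∈ CQ.terms φ := ⟨φ, hφ, hx⟩
    have he : h.choose = φ := by
      by_contra hne
      exact hdisj _ h.choose_spec.1 _ hφ hne x h.choose_spec.2 hx
    simp only [g, dif_pos h, he]

/-! ### From r-satisfiability to an r-complete tuple -/

section Forward

variable {RC : Set C} {RR : Set P} {K : TKB I C P} {Φ : TCQ I V C P} {k : ℕ}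
  {W : Fin k → Set (CQ I V C P)} {ι : Fin (K.n + 1) → Fin k}

theorem RSatisfiable.exists_isRComplete [Nonempty I] (hO : K.onto.IsHorn) (hK : K.NamesInOntology)
    (hΦ : Φ.Admissible K) (hW : ∀ l, W l ⊆ Φ.cqs) (h : RSatisfiable RC RR K Φ W ι) :
    ∃ (AR : Set (Assertion I C P)) (QR QRn : Set (CQ I V C P)) (RF : Set (Role P × Term I V)),
      IsRComplete RC RR K Φ W ι AR QR QRn RF := by
  obtain ⟨Δ, J, hJ, hJ'⟩ := h
  have i₀ : Fin (K.n + 1 + k) := ⟨0, by omega⟩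
  let AR : Set (Assertion I C P) := {α |
    α.fact.BuiltFrom K.inds (RC ∩ K.onto.conceptNames) (RR ∩ K.onto.roleNames) ∧
      (J i₀).SatAssertion α}
  let QR : Set (CQ I V C P) := ⋃ i, worldAt W ι i
  have hAR : IsRigidABoxType RC RR K AR :=
    ⟨fun α hα => hα.1, fun β hβ => ⟨fun h h' => h.2 h'.2, fun h => ⟨hβ, fun h' => h ⟨hβ, h'⟩⟩⟩⟩
  have hWcq : ∀ i : Fin (K.n + 1 + k), worldAt W ι i ⊆ Φ.cqs := fun i => hW _
  have hQR : QR ⊆ Φ.cqs := Set.iUnion_subset hWcq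
  have hWQ : ∀ i, worldAt W ι i ⊆ QR := Set.subset_iUnion _
  have hval : ∀ i, ∃ G : XInd I V P → Δ, (∀ a, G (XInd.ofInd a) = (J i).ind a) ∧
      (∀ φ ∈ QR, ∃ m, (φ ∈ worldAt W ι i → m = i) ∧
        ∀ α ∈ φ, (J m).SatAtom (fun t => G (XInd.ofTerm t)) α) ∧
      ∀ b S, (∃ m, G (XInd.ofTerm b) ∈ (J m).basic (.ex S)) →
        ∃ m, G (XInd.ofTerm b) ∈ (J m).basic (.ex S) ∧
        ∀ σ U, (σ ++ [U]).head? = some S → G ⟨b, σ ++ [U]⟩ = (J m).succ U (G ⟨b, σ⟩) := by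
    intro i
    obtain ⟨g, h1, h2⟩ := exists_root_values (Q := QR) (fun i j => (hJ i j).1)
      (fun i => (hJ' i).2.2.1)
      (fun φ hφ φ' hφ' => hΦ.disjointVars φ (hQR hφ) φ' (hQR hφ'))
      (fun φ hφ => Set.mem_iUnion.1 hφ) i
    obtain ⟨G, h3, h4⟩ := exists_tree_values J i g
    refine ⟨G, fun a => (h3 _).trans (h1 a), ?_, ?_⟩
    · simpa only [h3] using h2
    · simpa only [h3] using h4
  choose G hGind hGQ hGtree using hval
  have hQmodel : ∀ i, ∀ φ ∈ QR, ∃ m, (φ ∈ worldAt W ι i → m = i) ∧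
      ((J m).pullback (G i)).IsModel (KB.mk K.onto (CQ.toABox φ)) := by
    intro i φ hφ
    obtain ⟨m, hm, h⟩ := hGQ i φ hφ
    refine ⟨m, hm, (hJ' m).1.pullback, ?_⟩
    rintro _ ⟨α, hα, rfl⟩
    have := h α hα
    cases α with
    | conc B t => exact Interp.mem_pullback_basic.2 this
    | role R s t => exact Interp.mem_pullback_role.2 this
  have hbase : ∀ i, ((J i).pullback (G i)).IsModel (baseKB RC RR K W ι AR QR i) := by
    refine fun i => ⟨(hJ' i).1.pullback, ?_⟩
    rintro α (((⟨β, hβ, rfl⟩ | hα) | hα) | ⟨β, hβ, rfl⟩)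
    · rw [Interp.pullback_satAssertion (hGind i)]
      have h1 : (J i).SatFact β.fact ↔ (J i₀).SatFact β.fact := by
        have := hβ.1
        generalize β.fact = γ at this
        rcases γ with ⟨A | R, a⟩ | ⟨R, a, b⟩
        · rw [Interp.SatFact, Interp.SatFact, (hJ i i₀).1,
            hJ.basic_eq (B := .atomic A) this.1.1 i i₀]
        · rw [Interp.SatFact, Interp.SatFact, (hJ i i₀).1,
            hJ.basic_eq (B := .ex R) this.1.1 i i₀]
        · rw [Interp.SatFact, Interp.SatFact, (hJ i i₀).1, hJ.role_eq this.1.1 i i₀]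
      have h2 := hβ.2
      cases β with
      | pos β => exact h1.2 h2
      | neg β => exact fun h => h2 (h1.1 h)
    -- The consequence holds in `J m`, where `G i` matches `φ`, and its name is rigid.
    · obtain ⟨φ, hφ, β, rfl, h1, h2⟩ := hα
      obtain ⟨m, -, hm⟩ := hQmodel i φ hφ
      have h3 := h2 _ _ hm
      rcases β with ⟨A | R, a⟩ | ⟨R, a, b⟩
      · refine Interp.mem_pullback_basic.2 ?_
        rw [hJ.basic_eq (B := .atomic A) h1.1.1 i m]
        exact Interp.mem_pullback_basic.1 h3
      · refine Interp.mem_pullback_basic.2 ?_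
        rw [hJ.basic_eq (B := .ex R) h1.1.1 i m]
        exact Interp.mem_pullback_basic.1 h3
      · refine Interp.mem_pullback_role.2 ?_
        rw [hJ.role_eq h1.1.1 i m]
        exact Interp.mem_pullback_role.1 h3
    · simp only [queriesABox, Set.mem_iUnion] at hα
      obtain ⟨φ, hφ, hα⟩ := hα
      obtain ⟨m, hm, hm'⟩ := hQmodel i φ (hWQ i hφ)
      obtain rfl := hm hφ
      exact hm'.2 _ hα
    · exact (Interp.pullback_satAssertion (hGind i)).2 ((hJ' i).2.1 β hβ)
  let RF : Set (Role P × Term I V) := {q | (q.1.name ∈ K.onto.roleNames \ RR ∧ q.2 ∈ roots K Φ) ∧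
    ∃ i, (baseKB RC RR K W ι AR QR i).EntailsFact (.conc (.ex q.1) (XInd.ofTerm q.2))}
  -- An original name denotes the same element at the entailing time `j`. The value of an auxiliary
  -- name may differ there, but its entailed existentials follow from its query alone, or from no
  -- assertion at all, and so hold where `G i` matches that query.
  have hRF : ∀ q ∈ RF, ∀ i, ∃ m, G i (XInd.ofTerm q.2) ∈ (J m).basic (.ex q.1) := by
    rintro ⟨S, b⟩ ⟨_, j, hj⟩ i
    dsimp only at hj ⊢
    by_cases hb : ∃ a, b = .ind a
    · obtain ⟨a, rfl⟩ := hb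
      refine ⟨j, ?_⟩
      have h1 := Interp.mem_pullback_basic.1 (hj _ _ (hbase j))
      have h2 : G i (XInd.ofInd a) = G j (XInd.ofInd a) := by
        rw [hGind, hGind, (hJ i j).1]
      exact h2 ▸ h1
    · have h1 := closure_of_entailsFact hO ⟨_, _, hbase j⟩ hj
      rcases closure_base_cases hO hK hΦ hAR hQR (hWQ j)
        (by rintro ⟨a, _, ha⟩; exact hb ⟨a, XInd.ofTerm_injective ha⟩) h1 with
        h2 | ⟨φ, hφ, t, ht, htb, h2⟩
      · exact ⟨i, h2.sound hO (hJ' i).1 (by simp)⟩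
      · obtain ⟨m, -, hm⟩ := hQmodel i φ hφ
        exact ⟨m, Interp.mem_pullback_basic.1 (h2 _ _ hm)⟩
  have hlocal : ∀ i, ((J i).pullback (G i)).IsModel (localKB RC RR K Φ W ι AR QR RF i) := by
    refine fun i => ⟨(hbase i).1, ?_⟩
    rintro α (hα | hα)
    · exact (hbase i).2 α hα
    · simp only [flexABox, Set.mem_iUnion] at hα
      obtain ⟨q, hq, hα⟩ := hα
      obtain ⟨m, h1, h2⟩ := hGtree i q.2 q.1 (hRF q hq i)
      exact treeABox_sat hJ (hJ' m).1 h1 h2 i α hα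
  refine ⟨AR, QR, ⋃ i : Fin (K.n + 1 + k), Φ.cqs \ worldAt W ι i, RF, ?_⟩
  refine ⟨hAR, hQR, Set.iUnion_subset fun i => Set.sdiff_subset, fun q hq => hq.1,
    fun i => ⟨_, _, hlocal i⟩, fun i φ hφ h => ?_, hWQ,
    Set.subset_iUnion (fun i : Fin (K.n + 1 + k) => Φ.cqs \ worldAt W ι i),
    fun i φ hφ ψ hψ h => ?_, fun S b hS hb => ⟨fun h => h.2, fun h => ⟨⟨hS, hb⟩, h⟩⟩⟩
  · exact (hJ' i).2.2.2 φ hφ (Interp.satCQ_of_pullback _ (hGind i) (h _ _ (hlocal i)))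
  -- An entailed witness is true in `J i`, by rigidity in `J m`, and there it enforces `φ`, which is
  -- missing from the world at `m`.
  · obtain ⟨m, hm⟩ := Set.mem_iUnion.1 hφ
    obtain ⟨π, h1, h2⟩ := Interp.satCQ_of_pullback _ (hGind i) (h _ _ (hlocal i))
    refine (hJ' m).2.2.2 φ hm (hψ.2.2 _ _ (hJ' m).1 ⟨π, fun a => by rw [h1, (hJ i m).1], ?_⟩)
    intro α hα
    have h3 := h2 α hα
    have h4 := hψ.1 α hα
    cases α with
    | conc B t => rw [Interp.SatAtom, ← hJ.basic_eq h4 i m]; exact h3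
    | role R s t => rw [Interp.SatAtom, ← hJ.role_eq h4 i m]; exact h3

end Forward

/-! ### Finiteness -/

theorem Ontology.finite_conceptNames (O : Ontology C P) : O.conceptNames.Finite := by
  have h : (⋃ α ∈ (O.cis : Set (CI C P)),
      (BasicConcept.atomic ⁻¹' (α.lhs : Set (BasicConcept C P))) ∪
      (BasicConcept.atomic ⁻¹' (α.rhs : Set (BasicConcept C P)))).Finite := by
    have hi : Function.Injective (BasicConcept.atomic : C → BasicConcept C P) :=
      fun _ _ h => BasicConcept.atomic.inj h
    exact O.cis.finite_toSet.biUnion fun α _ =>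
      (α.lhs.finite_toSet.preimage hi.injOn).union (α.rhs.finite_toSet.preimage hi.injOn)
  refine h.subset ?_
  rintro A ⟨α, hα, h⟩
  exact Set.mem_biUnion hα h

theorem finite_name_preimage {SP : Set P} (h : SP.Finite) :
    {R : Role P | R.name ∈ SP}.Finite := by
  refine ((h.image Role.prim).union (h.image Role.inv)).subset ?_
  rintro (p | p) hp
  · exact Or.inl ⟨p, hp, rfl⟩
  · exact Or.inr ⟨p, hp, rfl⟩

theorem Ontology.finite_roleNames (O : Ontology C P) : O.roleNames.Finite := by
  have hi : Function.Injective (BasicConcept.ex : Role P → BasicConcept C P) :=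
    fun _ _ h => BasicConcept.ex.inj h
  have h1 : (⋃ α ∈ (O.cis : Set (CI C P)),
      (BasicConcept.ex ⁻¹' (α.lhs : Set (BasicConcept C P))) ∪
      (BasicConcept.ex ⁻¹' (α.rhs : Set (BasicConcept C P)))).Finite :=
    O.cis.finite_toSet.biUnion fun α _ =>
      (α.lhs.finite_toSet.preimage hi.injOn).union (α.rhs.finite_toSet.preimage hi.injOn)
  have h2 := ((h1.image Role.name).union (O.ris.finite_toSet.image fun α => α.sub.name)).union
    (O.ris.finite_toSet.image fun α => α.sup.name)
  refine h2.subset ?_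
  rintro p (⟨α, hα, R, rfl, h⟩ | ⟨α, hα, h | h⟩)
  · exact Or.inl (Or.inl ⟨R, Set.mem_biUnion hα h, rfl⟩)
  · exact Or.inl (Or.inr ⟨α, hα, h⟩)
  · exact Or.inr ⟨α, hα, h⟩

/-- Allows the set of all true rigid atoms over the terms of a query to be taken as a query. -/
theorem finite_atoms {SC : Set C} {SP : Set P} {U : Set (Term I V)} (hC : SC.Finite)
    (hP : SP.Finite) (hU : U.Finite) :
    {α : Atom I V C P | α.BuiltFrom SC SP ∧ α.terms ⊆ U}.Finite := by
  have hR := finite_name_preimage hP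
  have hB : {B : BasicConcept C P | B.BuiltFrom SC SP}.Finite := by
    refine ((hC.image .atomic).union (hR.image .ex)).subset ?_
    rintro (A | R) h
    · exact Or.inl ⟨A, h, rfl⟩
    · exact Or.inr ⟨R, h, rfl⟩
  refine (((hB.prod hU).image fun q => Atom.conc q.1 q.2).union
    ((hR.prod (hU.prod hU)).image fun q => Atom.role q.1 q.2.1 q.2.2)).subset ?_
  rintro (⟨B, t⟩ | ⟨R, s, t⟩) ⟨h1, h2⟩
  · exact Or.inl ⟨(B, t), ⟨h1, h2 rfl⟩, rfl⟩
  · exact Or.inr ⟨(R, s, t), ⟨h1, h2 (Or.inl rfl), h2 (Or.inr rfl)⟩, rfl⟩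

theorem lt_ncard_of_forall_le {α : Type} {s : Set α} (hs : s.Finite) {f : α → ℕ} {n : ℕ}
    (h : ∀ m ≤ n, ∃ a ∈ s, f a = m) : n < s.ncard := by
  have h1 : (Finset.range (n + 1) : Set ℕ) ⊆ f '' s := by
    intro m hm
    exact h m (by simpa [Nat.lt_succ_iff] using hm)
  have h2 := Set.ncard_le_ncard h1 (hs.image f)
  rw [Set.ncard_coe_finset, Finset.card_range] at h2
  exact h2.trans (Set.ncard_image_le hs)

/-! ### Reducts -/

section Reduct

variable {I' : Type} {M : Interp I' C P Δ} {f : I → I'} {hf : Function.Injective f}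

theorem Interp.reduct_satOntology {O : Ontology C P} (h : M.SatOntology O) :
    (M.reduct f hf).SatOntology O := by
  refine ⟨fun α hα x hx => ?_, fun α hα => ?_⟩
  · simp only [Interp.reduct_basic] at hx ⊢
    exact h.1 α hα x hx
  · simpa only [Interp.SatRI, Interp.reduct_role] using h.2 α hα

theorem Interp.reduct_satAssertion {α : Assertion I C P} :
    (M.reduct f hf).SatAssertion α ↔ M.SatAssertion (α.map f) := by
  rcases α with (⟨B, a⟩ | ⟨R, a, b⟩) | (⟨B, a⟩ | ⟨R, a, b⟩) <;>
  · simp only [Interp.SatAssertion, Interp.SatFact, Assertion.map, Fact.map, Interp.reduct_basic,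
      Interp.reduct_role]
    rfl

theorem RespectRigid.reduct {RC : Set C} {RR : Set P} {J : T → Interp I' C P Δ}
    (h : RespectRigid RC RR J) : RespectRigid RC RR fun i => (J i).reduct f hf :=
  fun i j => ⟨congrArg (· ∘ f) (h i j).1, fun A hA => (h i j).2.1 A hA, fun p hp => (h i j).2.2 p hp⟩

end Reduct

/-! ### Paths in the amalgam -/

section Paths

variable {RC : Set C} {RR : Set P} {O : Ontology C P} {A : T → Set (Assertion N C P)}

theorem anchor_eq_self_cons {i : T} {b : N} {S : Role P} {ρ : List (Role P)}
    (h : anchor RC RR O A i b (S :: ρ) = S :: ρ) : .ex S ∉ typ RC RR O A i b ρ := by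
  intro h'
  rw [anchor, if_pos h'] at h
  have := (anchor_suffix (RC := RC) (RR := RR) (O := O) (A := A) i b ρ).length_le
  rw [h] at this
  simp at this

theorem typ_of_anchor_eq {i : T} {b : N} {S : Role P} {ρ : List (Role P)}
    (h : anchor RC RR O A i b (S :: ρ) = S :: ρ) {B : BasicConcept C P}
    (hB : B ∈ typ RC RR O A i b (S :: ρ)) :
    Closure O {B' | B'.BuiltFrom RC RR ∧ Closure O {.ex S.inverse} B'} B :=
  hB.resolve_left fun h' => anchor_eq_self_cons h h'.1

/-- Node paths list the last role first, successor paths the first role first, whence the reversal.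
-/
theorem IsNode.successorPath (hO : O.IsHorn) {b : N} {ρ : List (Role P)} {S : Role P}
    (h : IsNode RC RR O A b ρ) (hl : ρ.getLast? = some S) (hS : S.name ∈ O.roleNames) :
    SuccessorPath I O S ρ.reverse := by
  induction ρ with
  | nil => simp at hl
  | cons S' ρ ih =>
    cases ρ with
    | nil =>
      obtain rfl : S' = S := by simpa using hl
      exact ⟨rfl, by simpa using hS, by simp⟩
    | cons S'' ρ =>
      obtain ⟨h1, h2, h3⟩ := ih h.1 (by simpa using hl)
      have h4 := h.closure
      refine ⟨List.head?_reverse.trans hl, ?_, ?_⟩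
      · intro R hR
        rw [List.mem_reverse, List.mem_cons] at hR
        rcases hR with rfl | hR
        · refine h4.builtFrom (B := .ex R) ?_
          rintro _ rfl
          simpa [BasicConcept.BuiltFrom] using h2 S'' (by simp)
        · exact h2 R (List.mem_reverse.2 hR)
      · rw [List.reverse_cons]
        refine List.isChain_append.2 ⟨h3, by simp, ?_⟩
        intro x hx y hy
        obtain rfl : S'' = x := by simpa using hx
        obtain rfl : S' = y := by simpa using hy
        intro Δ M hM z hz
        refine h4.sound hO hM ?_
        rintro _ rfl
        exact hz

/-- A generated child shares the anchor of its parent, and a child that is not generated is, like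
its parent, its own anchor. -/
theorem Edge.anchor_length_le {i : T} {R : Role P} {x y : N × List (Role P)}
    (hx : IsNode RC RR O A x.1 x.2) (hy : IsNode RC RR O A y.1 y.2)
    (h : Edge RC RR O A i R x y) :
    (anchor RC RR O A i y.1 y.2).length ≤ (anchor RC RR O A i x.1 x.2).length + 1 := by
  have key : ∀ (b : N) (S : Role P) (ρ : List (Role P)), IsNode RC RR O A b (S :: ρ) →
      (anchor RC RR O A i b ρ).length ≤ (anchor RC RR O A i b (S :: ρ)).length + 1 ∧
      (anchor RC RR O A i b (S :: ρ)).length ≤ (anchor RC RR O A i b ρ).length + 1 := by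
    intro b S ρ hn
    by_cases hS : BasicConcept.ex S ∈ typ RC RR O A i b ρ
    · rw [anchor, if_pos hS]
      omega
    · rw [anchor, if_neg hS, hn.anchor_parent hS, List.length_cons]
      omega
  cases h with
  | root h => simp [anchor]
  | down h => exact (key _ _ _ hy).2
  | up h => exact (key _ _ _ hx).1

/-- The last entry of a path is the role leaving the root, so it identifies the tree; different
trees are linked through roots only. -/
theorem Edge.same_tree {i : T} {R : Role P} {x y : N × List (Role P)}
    (hx : x.2 ≠ []) (hy : y.2 ≠ []) (h : Edge RC RR O A i R x y) :
    x.1 = y.1 ∧ x.2.getLast? = y.2.getLast? := by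
  cases h with
  | root h => exact absurd rfl hx
  | @down b ρ S h =>
    cases ρ with
    | nil => exact absurd rfl hx
    | cons => simp
  | @up b ρ S h =>
    cases ρ with
    | nil => exact absurd rfl hy
    | cons => simp

theorem getLast?_eq_of_suffix {α : Type} {l l' : List α} (h : l <:+ l') (hl : l ≠ []) :
    l.getLast? = l'.getLast? := by
  obtain ⟨t, rfl⟩ := h
  rw [List.getLast?_append_of_ne_nil t hl]

end Paths

/-! ### From an r-complete tuple to r-satisfiability -/

section Backward

variable {RC : Set C} {RR : Set P} {K : TKB I C P} {Φ : TCQ I V C P} {k : ℕ}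
  {W : Fin k → Set (CQ I V C P)} {ι : Fin (K.n + 1) → Fin k} {AR : Set (Assertion I C P)}
  {QR QRn : Set (CQ I V C P)} {RF : Set (Role P × Term I V)}

local notation "𝔸" => baseABox RC RR K W ι AR QR

namespace IsRComplete

variable (h : IsRComplete RC RR K Φ W ι AR QR QRn RF)
include h

theorem amalgamable (hO : K.onto.IsHorn) (hK : K.NamesInOntology) (hΦ : Φ.Admissible K) :
    Amalgamable RC RR K.onto 𝔸 :=
  amalgamable_base hO hK hΦ h.rigidType h.subQR h.posMem fun i =>
    let ⟨Δ, M, hM⟩ := h.consistent i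
    ⟨Δ, M, hM.1, fun α hα => hM.2 α (Or.inl hα)⟩

theorem name_mem (hK : K.NamesInOntology) (hΦ : Φ.Admissible K) {j : Fin (K.n + 1 + k)}
    {b : XInd I V P} {S : Role P}
    (hS : .ex S ∈ typ RC RR K.onto 𝔸 j b []) :
    S.name ∈ K.onto.roleNames :=
  closure_base_builtFrom (B := .ex S) hK hΦ h.rigidType h.subQR (h.posMem j) hS

/-- The trees that are not generated at `i` belong to flexible existential assertions. -/
theorem mem_flexible (hO : K.onto.IsHorn) (hK : K.NamesInOntology) (hΦ : Φ.Admissible K)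
    {i : Fin (K.n + 1 + k)} {b : XInd I V P} {ρ : List (Role P)}
    (hn : IsNode RC RR K.onto 𝔸 b ρ) (hρ : ρ ≠ [])
    (ha : anchor RC RR K.onto 𝔸 i b ρ = ρ) :
    ∃ S t, b = XInd.ofTerm t ∧ (S, t) ∈ RF ∧ SuccessorPath I K.onto S ρ.reverse := by
  obtain ⟨S, j, hl, hS⟩ := hn.exists_last hρ
  have hname := h.name_mem hK hΦ hS
  have hi : .ex S ∉ typ RC RR K.onto 𝔸 i b [] := fun hi =>
    hρ (ha ▸ anchor_eq_nil hi hn hl)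
  -- A rigid `∃S` at the root would be in its type at `i` as well, and the tree would be generated.
  have hRR : S.name ∉ RR := fun hR =>
    hi ((h.amalgamable hO hK hΦ).agreeConc j i b (.ex S) hR hS)
  obtain ⟨t, rfl, ht⟩ : ∃ t, b = XInd.ofTerm t ∧ t ∈ roots K Φ := by
    by_cases hb : ∃ a ∈ K.inds, b = XInd.ofInd a
    · obtain ⟨a, haK, rfl⟩ := hb
      exact ⟨.ind a, rfl, Or.inl ⟨a, haK, rfl⟩⟩
    · rcases closure_base_cases hO hK hΦ h.rigidType h.subQR (h.posMem j) hb hS with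
        h' | ⟨φ, hφ, t, ht, rfl, -⟩
      · exact absurd (h'.mono (Set.empty_subset _)) hi
      · refine ⟨t, rfl, ?_⟩
        cases t with
        | ind a => exact absurd ⟨a, hΦ.inds φ (h.subQR hφ) a ht, rfl⟩ hb
        | var x => exact Or.inr ⟨x, rfl, φ, h.subQR hφ, ht⟩
  refine ⟨S, t, rfl, (h.flexible S t ⟨hname, hRR⟩ ht).2 ⟨j, fun _ M hM => ?_⟩,
    hn.successorPath hO hl hname⟩
  exact Closure.sound hO hM.1 (fun _ h => seeds_sound hM.2 h) hS

/-- The part of the amalgam close to the generated trees is matched in all models of the local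
knowledge base. -/
theorem satCQ_of_anchor_le (hO : K.onto.IsHorn) (hK : K.NamesInOntology) (hΦ : Φ.Admissible K)
    [Nonempty I] {i : Fin (K.n + 1 + k)} {M : Interp (XInd I V P) C P Δ}
    (hM : M.IsModel (localKB RC RR K Φ W ι AR QR RF i)) {φ : CQ I V C P}
    {π : Term I V → Node RC RR K.onto 𝔸}
    (hπ : ∀ a, π (.ind a) = Node.root (XInd.ofInd a))
    (hconc : ∀ B t, Atom.conc B t ∈ φ →
      B ∈ typ RC RR K.onto 𝔸 i (π t).1.1 (π t).1.2)
    (hrole : ∀ R s t, Atom.role R s t ∈ φ →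
      Edge RC RR K.onto 𝔸 i R (π s).1 (π t).1)
    (hd : ∀ t ∈ CQ.terms φ, (anchor RC RR K.onto 𝔸 i
      (π t).1.1 (π t).1.2).length ≤ Φ.maxTerms) :
    (M.reduct XInd.ofInd XInd.ofInd_injective).SatCQ φ := by
  -- An anchor is sent to the tree name with the same path; `D` bounds the depth by the depth to
  -- which the ABoxes of `RF` describe the trees.
  let f : XInd I V P × List (Role P) → Δ := fun x => M.ind ⟨x.1.root, x.1.path ++ x.2.reverse⟩
  let D : XInd I V P → List (Role P) → Prop := fun b ρ =>
    IsNode RC RR K.onto 𝔸 b ρ ∧ ρ.length ≤ Φ.maxTerms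
  have hMA : M.SatABox (𝔸 i) := fun α hα => hM.2 α (Or.inl hα)
  have htree : ∀ S t, (S, t) ∈ RF → ∀ α ∈ treeABox RC RR K.onto Φ.maxTerms S t,
      M.SatAssertion α := by
    intro S t hS α hα
    refine hM.2 α (Or.inr ?_)
    exact Set.mem_biUnion hS hα
  have hf : ∀ b ρ, D b ρ → anchor RC RR K.onto 𝔸 i b ρ = ρ → ∀ B ∈ typ RC RR K.onto 𝔸 i b ρ,
      f (b, ρ) ∈ M.basic B := by
    intro b ρ hD ha B hB
    cases ρ with
    | nil =>
      have : f (b, []) = M.ind b := by simp [f]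
      rw [this]
      exact Closure.sound hO hM.1 (fun _ h => seeds_sound hMA h) hB
    | cons S' ρ =>
      obtain ⟨S, t, rfl, hS, hp⟩ := h.mem_flexible hO hK hΦ hD.1 (by simp) ha
      -- It suffices to satisfy the rigid consequences of the incoming role, and these are asserted
      -- by the ABox of `∃S(t)`.
      refine (typ_of_anchor_eq ha hB).sound hO hM.1 ?_
      rintro B' ⟨hB', hB''⟩
      rw [List.reverse_cons] at hp
      have hname : S'.name ∈ K.onto.roleNames := hp.2.1 S' (by simp)
      have hBO : B'.BuiltFrom K.onto.conceptNames K.onto.roleNames := by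
        refine hB''.builtFrom ?_
        rintro _ rfl
        simpa [BasicConcept.BuiltFrom] using hname
      have := htree S t hS (.pos (.conc B' ⟨t, ρ.reverse ++ [S']⟩)) ⟨ρ.reverse, S', hp,
        by simpa using hD.2, Or.inl ⟨B', hB'.inter hBO, ?_, rfl⟩⟩
      · simpa [f, XInd.ofTerm, Interp.SatAssertion, Interp.SatFact] using this
      · intro _ M' hM' z hz
        refine hB''.sound hO hM' ?_
        rintro _ rfl
        exact hz
  have hdown : ∀ R S b ρ, D b ρ → D b (S :: ρ) → anchor RC RR K.onto 𝔸 i b (S :: ρ) = S :: ρ →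
      RoleLe K.onto S R → R.name ∈ RR → (f (b, ρ), f (b, S :: ρ)) ∈ M.role R := by
    intro R S' b ρ _ hD ha hle hR
    obtain ⟨S, t, rfl, hS, hp⟩ := h.mem_flexible hO hK hΦ hD.1 (by simp) ha
    rw [List.reverse_cons] at hp
    have hname : S'.name ∈ K.onto.roleNames := hp.2.1 S' (by simp)
    have := htree S t hS (.pos (.role R ⟨t, ρ.reverse⟩ ⟨t, ρ.reverse ++ [S']⟩)) ⟨ρ.reverse, S', hp,
        by simpa using hD.2, Or.inr ⟨R, ⟨hR, hle.name_mem hname⟩, fun _ M' hM' => hle.sound hM',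
          rfl⟩⟩
    simpa [f, XInd.ofTerm, Interp.SatAssertion, Interp.SatFact] using this
  have hroot : ∀ R b c, D b [] → D c [] → RootEdge K.onto (𝔸 i) R b c →
      (f (b, []), f (c, [])) ∈ M.role R := by
    intro R b c _ _ hR
    simpa [f] using hR.sound hM.1 hMA
  have hDt : ∀ t ∈ CQ.terms φ, D (π t).1.1 (anchor RC RR K.onto 𝔸 i (π t).1.1 (π t).1.2) :=
    fun t ht => ⟨(π t).2.of_suffix (anchor_suffix _ _ _), hd t ht⟩
  refine ⟨fun t => ext RC RR K.onto 𝔸 M f i (π t).1.1 (π t).1.2, fun a => ?_, fun α hα => ?_⟩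
  · dsimp only
    rw [hπ]
    simp [ext, Node.root, f, Interp.reduct, XInd.ofInd]
  · refine (Interp.reduct_satAtom _ _ _ _).2 ?_
    cases α with
    | conc B t => exact ext_typ hO hM.1 hf (hDt t ⟨_, hα, rfl⟩) (hconc B t hα)
    | role R s t =>
      exact ext_edge hO hM.1 hf hroot hdown (π s).2 (π t).2 (hDt s ⟨_, hα, Or.inl rfl⟩)
        (hDt t ⟨_, hα, Or.inr rfl⟩) (hrole R s t hα)

/-- A query that is matched in the part of a tree that is not generated at `i` has a rigid witness
that is entailed at the time at which the tree is generated. -/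
theorem exists_witness (hO : K.onto.IsHorn) (hK : K.NamesInOntology) (hΦ : Φ.Admissible K)
    [Nonempty I] {i : Fin (K.n + 1 + k)} {φ : CQ I V C P}
    {π : Term I V → Node RC RR K.onto 𝔸}
    (hπ : ∀ a, π (.ind a) = Node.root (XInd.ofInd a))
    (hconc : ∀ B t, Atom.conc B t ∈ φ →
      B ∈ typ RC RR K.onto 𝔸 i (π t).1.1 (π t).1.2)
    (hrole : ∀ R s t, Atom.role R s t ∈ φ →
      Edge RC RR K.onto 𝔸 i R (π s).1 (π t).1)
    (hne : ∀ t ∈ CQ.terms φ, anchor RC RR K.onto 𝔸 i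
      (π t).1.1 (π t).1.2 ≠ [])
    (hφ : CQ.Connected φ) {t₀ : Term I V} (ht₀ : t₀ ∈ CQ.terms φ) :
    ∃ ψ : CQ I V C P, IsRigidWitness RC RR K.onto φ ψ ∧
      ∃ j, (localKB RC RR K Φ W ι AR QR RF j).EntailsCQ ψ := by
  classical
  have hA := h.amalgamable hO hK hΦ
  have hpath : ∀ t ∈ CQ.terms φ, (π t).1.2 ≠ [] := by
    intro t ht h0
    apply hne t ht
    rw [h0, anchor]
  obtain ⟨b, hb⟩ : ∃ b, b = (π t₀).1.1 := ⟨_, rfl⟩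
  -- `j` is a time that generates the tree around `t₀`; by connectedness the whole match lies in
  -- this tree.
  obtain ⟨S, j, hlast, hS⟩ := (π t₀).2.exists_last (hpath t₀ ht₀)
  rw [← hb] at hS
  have hname := h.name_mem hK hΦ hS
  have htree : ∀ t ∈ CQ.terms φ, (π t).1.1 = b ∧ (π t).1.2.getLast? = some S := by
    intro t ht
    have hpt := hφ t₀ ht₀ t ht
    clear ht
    induction hpt with
    | refl => exact ⟨hb.symm, hlast⟩
    | tail _ hst ih =>
      obtain ⟨R, hR | hR⟩ := hst
      · have := (hrole _ _ _ hR).same_tree (hpath _ ⟨_, hR, Or.inl rfl⟩)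
          (hpath _ ⟨_, hR, Or.inr rfl⟩)
        exact ⟨this.1 ▸ ih.1, this.2 ▸ ih.2⟩
      · have := (hrole _ _ _ hR).same_tree (hpath _ ⟨_, hR, Or.inl rfl⟩)
          (hpath _ ⟨_, hR, Or.inr rfl⟩)
        exact ⟨this.1.trans ih.1, this.2.trans ih.2⟩
  let ad : Term I V → List (Role P) := fun t => anchor RC RR K.onto 𝔸 i (π t).1.1 (π t).1.2
  let an : Term I V → Node RC RR K.onto 𝔸 := fun t =>
    ⟨((π t).1.1, ad t), (π t).2.of_suffix (anchor_suffix _ _ _)⟩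
  have han : ∀ t ∈ CQ.terms φ, (an t).1 = (b, ad t) := fun t ht =>
    Prod.ext (htree t ht).1 rfl
  have hadlast : ∀ t ∈ CQ.terms φ, (ad t).getLast? = some S := fun t ht =>
    (getLast?_eq_of_suffix (anchor_suffix _ _ _) (hne t ht)).trans (htree t ht).2
  have hadnode : ∀ t ∈ CQ.terms φ, IsNode RC RR K.onto 𝔸 b (ad t) := fun t ht =>
    (htree t ht).1 ▸ (an t).2
  have hadj : ∀ t ∈ CQ.terms φ, anchor RC RR K.onto 𝔸 j b (ad t) = [] := fun t ht =>
    anchor_eq_nil hS (hadnode t ht) (hadlast t ht)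
  -- The witness has no equalities, so its matches may separate terms with a common anchor. Choosing
  -- one term per anchor gives a map on nodes.
  have hr : ∃ r : List (Role P) → Term I V, ∀ t ∈ CQ.terms φ,
      r (ad t) ∈ CQ.terms φ ∧ ad (r (ad t)) = ad t := by
    refine ⟨fun σ => if hσ : ∃ t ∈ CQ.terms φ, ad t = σ then hσ.choose else t₀, fun t ht => ?_⟩
    have hσ : ∃ t' ∈ CQ.terms φ, ad t' = ad t := ⟨t, ht, rfl⟩
    dsimp only
    rw [dif_pos hσ]
    exact hσ.choose_spec
  obtain ⟨r, hr⟩ := hr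
  -- The witness consists of all rigid atoms over the terms of `φ` that hold at `i` when each term
  -- is moved to its anchor. Restricting to names of the ontology makes it finite.
  have hfin : {α : Atom I V C P | (α.BuiltFrom (RC ∩ K.onto.conceptNames) (RR ∩ K.onto.roleNames) ∧
      α.terms ⊆ CQ.terms φ) ∧
      ((amalgam RC RR K.onto 𝔸 i).reduct XInd.ofInd XInd.ofInd_injective).SatAtom an α}.Finite :=
    (finite_atoms (K.onto.finite_conceptNames.subset Set.inter_subset_right)
      (K.onto.finite_roleNames.subset Set.inter_subset_right)
      (CQ.finite_terms φ)).subset fun α hα => hα.1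
  obtain ⟨ψ, hψ⟩ : ∃ ψ : CQ I V C P, ∀ α, α ∈ ψ ↔
      (α.BuiltFrom (RC ∩ K.onto.conceptNames) (RR ∩ K.onto.roleNames) ∧
      α.terms ⊆ CQ.terms φ) ∧
      ((amalgam RC RR K.onto 𝔸 i).reduct XInd.ofInd XInd.ofInd_injective).SatAtom an α :=
    ⟨hfin.toFinset, fun α => hfin.mem_toFinset⟩
  -- Individual names are mapped to roots, which the match avoids.
  have hvar : ∀ a, Term.ind a ∉ CQ.terms φ := fun a ha => hpath _ ha (by rw [hπ]; rfl)
  have hterms : CQ.terms ψ ⊆ CQ.terms φ := by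
    rintro t ⟨α, hα, ht⟩
    exact ((hψ α).1 hα).1.2 ht
  refine ⟨ψ, ⟨?_, Set.ncard_le_ncard hterms (CQ.finite_terms φ), ?_⟩, j, ?_⟩
  · intro α hα
    have := ((hψ α).1 hα).1.1
    rcases α with ⟨_ | _, t⟩ | ⟨R, s, t⟩
    · exact this.1
    · exact this.1
    · exact this.1
  · rintro Δ M hM ⟨ξ, -, hξ⟩
    let f : XInd I V P × List (Role P) → Δ := fun x => ξ (r x.2)
    let D : XInd I V P → List (Role P) → Prop := fun b' σ => b' = b ∧ ∃ t ∈ CQ.terms φ, ad t = σ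
    have hf : ∀ b ρ, D b ρ → anchor RC RR K.onto 𝔸 i b ρ = ρ →
        ∀ B ∈ typ RC RR K.onto 𝔸 i b ρ, f (b, ρ) ∈ M.basic B := by
      rintro _ ρ ⟨rfl, t, ht, hρ⟩ ha B hB
      have hn := hadnode t ht
      have hp := hn.successorPath (I := I) hO (hadlast t ht) hname
      have hrt := hr t ht
      have hρ0 := hne t ht
      change ad t ≠ [] at hρ0
      rw [hρ] at hn hp hrt hρ0
      cases ρ with
      | nil => exact absurd rfl hρ0
      | cons S' ρ =>
        refine (typ_of_anchor_eq ha hB).sound hO hM ?_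
        rintro B' ⟨hB', hB''⟩
        have hBO : B'.BuiltFrom K.onto.conceptNames K.onto.roleNames := by
          refine hB''.builtFrom ?_
          rintro _ rfl
          simpa [BasicConcept.BuiltFrom] using hp.2.1 S' (by simp)
        refine hξ (.conc B' (r (S' :: ρ))) ((hψ _).2 ⟨⟨hB'.inter hBO, ?_⟩, ?_⟩)
        · rintro _ rfl
          exact hrt.1
        · refine (Interp.reduct_satAtom _ _ _ _).2 (hA.basic_iff.2 ?_)
          rw [han _ hrt.1, hrt.2]
          exact Or.inr (.base ⟨hB', hB''⟩)
    have hroot : ∀ R b c, D b [] → D c [] → RootEdge K.onto (𝔸 i) R b c →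
        (f (b, []), f (c, [])) ∈ M.role R := by
      rintro R b' c ⟨_, t, ht, ht'⟩
      exact absurd ht' (hne t ht)
    have hdown : ∀ R S b ρ, D b ρ → D b (S :: ρ) →
        anchor RC RR K.onto 𝔸 i b (S :: ρ) = S :: ρ →
        RoleLe K.onto S R → R.name ∈ RR → (f (b, ρ), f (b, S :: ρ)) ∈ M.role R := by
      rintro R S' _ ρ ⟨rfl, t, ht, hρ⟩ ⟨-, t', ht', hρ'⟩ - hle hR
      have hp := (hadnode t' ht').successorPath (I := I) hO (hadlast t' ht') hname
      have hrt := hr t ht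
      have hrt' := hr t' ht'
      rw [hρ] at hrt
      rw [hρ'] at hrt' hp
      refine hξ (.role R (r ρ) (r (S' :: ρ)))
        ((hψ _).2 ⟨⟨⟨hR, hle.name_mem (hp.2.1 S' (by simp))⟩, ?_⟩, ?_⟩)
      · rintro _ (rfl | rfl)
        · exact hrt.1
        · exact hrt'.1
      · refine (Interp.reduct_satAtom _ _ _ _).2 (amalgam_role.2 ?_)
        rw [han _ hrt.1, hrt.2, han _ hrt'.1, hrt'.2]
        exact .down (Or.inr ⟨R, hR, hle, .refl⟩)
    have hDt : ∀ t ∈ CQ.terms φ, D (π t).1.1 (anchor RC RR K.onto 𝔸 i (π t).1.1 (π t).1.2) :=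
      fun t ht => ⟨(htree t ht).1, t, ht, rfl⟩
    refine ⟨fun t => match t with
      | .ind a => M.ind a
      | .var x => ext RC RR K.onto 𝔸 M f i (π (.var x)).1.1 (π (.var x)).1.2,
      fun a => rfl, fun α hα => ?_⟩
    refine Interp.SatAtom.congr (π := fun t => ext RC RR K.onto 𝔸 M f i (π t).1.1 (π t).1.2) ?_ ?_
    · cases α with
      | conc B t => exact ext_typ hO hM hf (hDt t ⟨_, hα, rfl⟩) (hconc B t hα)
      | role R s t =>
        exact ext_edge hO hM hf hroot hdown (π s).2 (π t).2 (hDt s ⟨_, hα, Or.inl rfl⟩)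
          (hDt t ⟨_, hα, Or.inr rfl⟩) (hrole R s t hα)
    · intro t ht
      cases t with
      | ind a => exact absurd ⟨α, hα, ht⟩ (hvar a)
      | var x => rfl
  -- By rigidity the atoms hold at `j` too, where the tree is generated from its root and so maps
  -- into every model.
  · intro Δ M hM
    have hMA : M.SatABox (𝔸 j) := fun α hα => hM.2 α (Or.inl hα)
    refine ⟨fun t => match t with
      | .ind a => M.ind (XInd.ofInd a)
      | .var x => ext RC RR K.onto 𝔸 M (fun x => M.ind x.1) j b (ad (.var x)),
      fun a => rfl, fun α hα => ?_⟩
    refine Interp.SatAtom.congr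
      (π := fun t => ext RC RR K.onto 𝔸 M (fun x => M.ind x.1) j b (ad t)) ?_ ?_
    · obtain ⟨⟨h1, h2⟩, h3⟩ := (hψ α).1 hα
      have h3 := (Interp.reduct_satAtom _ _ _ _).1 h3
      refine (Interp.reduct_satAtom _ _ _ _).2 ?_
      cases α with
      | conc B t =>
        have ht : t ∈ CQ.terms φ := h2 rfl
        have hB : B.BuiltFrom RC RR := by
          cases B with
          | atomic A => exact h1.1
          | ex R => exact h1.1
        have h4 := hA.basic_iff.1 (hA.basic_rigid (j := j) hB h3)
        rw [han t ht] at h4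
        exact ext_typ_of_model hO hM.1 hMA (hadj t ht) h4
      | role R s t =>
        have hs : s ∈ CQ.terms φ := h2 (Or.inl rfl)
        have ht : t ∈ CQ.terms φ := h2 (Or.inr rfl)
        have h4 := amalgam_role.1 (hA.role_rigid (j := j) h1.1 h3)
        rw [han t ht, han s hs] at h4
        exact ext_edge_of_model hO hM.1 hMA (x := (b, ad s)) (y := (b, ad t)) (hadnode s hs)
          (hadnode t ht) (hadj s hs) (hadj t ht) h4
    · intro t ht
      cases t with
      | ind a => exact absurd (hterms ⟨α, hα, ht⟩) (hvar a)
      | var x => rfl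

theorem rSatisfiable [Nonempty I] (hO : K.onto.IsHorn) (hK : K.NamesInOntology)
    (hΦ : Φ.Admissible K) : RSatisfiable RC RR K Φ W ι := by
  have hA := h.amalgamable hO hK hΦ
  refine ⟨Node RC RR K.onto 𝔸,
    fun i => (amalgam RC RR K.onto 𝔸 i).reduct XInd.ofInd
      XInd.ofInd_injective, hA.respectRigid.reduct, fun i =>
      ⟨Interp.reduct_satOntology (hA.satOntology i), fun α hα => ?_, fun φ hφ => ?_,
        fun φ hφ hsat => ?_⟩⟩
  · exact Interp.reduct_satAssertion.2 (hA.satABox i _ (Or.inr ⟨α, hα, rfl⟩))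
  · refine ⟨fun t => Node.root (XInd.ofTerm t), fun a => rfl, fun α hα => ?_⟩
    have h1 := hA.satABox i (.pos α.toFact)
      (Or.inl (Or.inr (Set.mem_biUnion hφ ⟨α, hα, rfl⟩)))
    refine (Interp.reduct_satAtom _ _ _ _).2 ?_
    cases α with
    | conc B t => exact h1
    | role R s t => exact h1
  · obtain ⟨π, hπ, hat⟩ := hsat
    have hconc : ∀ B t, Atom.conc B t ∈ φ →
        B ∈ typ RC RR K.onto 𝔸 i (π t).1.1 (π t).1.2 :=
      fun B t ht => hA.basic_iff.1 ((Interp.reduct_satAtom _ _ _ _).1 (hat _ ht))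
    have hrole : ∀ R s t, Atom.role R s t ∈ φ →
        Edge RC RR K.onto 𝔸 i R (π s).1 (π t).1 :=
      fun R s t ht => amalgam_role.1 ((Interp.reduct_satAtom _ _ _ _).1 (hat _ ht))
    have hclose : (∀ t ∈ CQ.terms φ, (anchor RC RR K.onto 𝔸 i
        (π t).1.1 (π t).1.2).length ≤ Φ.maxTerms) → False := fun hd =>
      h.negCQs i φ hφ fun _ M hM => h.satCQ_of_anchor_le hO hK hΦ hM hπ hconc hrole hd
    by_cases h0 : ∃ t₀ ∈ CQ.terms φ, anchor RC RR K.onto 𝔸 i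
        (π t₀).1.1 (π t₀).1.2 = []
    · obtain ⟨t₀, ht₀, h0⟩ := h0
      -- Starting from depth zero at `t₀`, anchor depth rises by at most one along each link of the
      -- query. Every depth up to that of `t` is therefore attained by some term, which bounds it by
      -- the number of terms.
      refine hclose fun t ht => (lt_ncard_of_forall_le (CQ.finite_terms φ)
        (f := fun t => (anchor RC RR K.onto 𝔸 i
          (π t).1.1 (π t).1.2).length) ?_).le.trans (TCQ.ncard_terms_le hφ.1)
      have hpt := hΦ.connected φ hφ.1 t₀ ht₀ t ht
      clear ht
      induction hpt with
      | refl =>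
        intro m hm
        refine ⟨t₀, ht₀, ?_⟩
        rw [h0] at hm ⊢
        exact (Nat.le_zero.1 hm).symm
      | @tail u v _ huv ih =>
        intro m hm
        have hv : v ∈ CQ.terms φ := by
          obtain ⟨R, hR | hR⟩ := huv
          · exact ⟨_, hR, Or.inr rfl⟩
          · exact ⟨_, hR, Or.inl rfl⟩
        have hle : (anchor RC RR K.onto 𝔸 i
            (π v).1.1 (π v).1.2).length ≤ (anchor RC RR K.onto 𝔸 i
            (π u).1.1 (π u).1.2).length + 1 := by
          obtain ⟨R, hR | hR⟩ := huv
          · exact (hrole _ _ _ hR).anchor_length_le (π u).2 (π v).2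
          · exact (hrole _ _ _ hR).symm.anchor_length_le (π u).2 (π v).2
        rcases hm.lt_or_eq with hm' | rfl
        · exact ih m (by omega)
        · exact ⟨v, hv, rfl⟩
    · have hne : ∀ t ∈ CQ.terms φ, anchor RC RR K.onto 𝔸 i
          (π t).1.1 (π t).1.2 ≠ [] := fun t ht h' => h0 ⟨t, ht, h'⟩
      by_cases hemp : ∃ t₀, t₀ ∈ CQ.terms φ
      · obtain ⟨t₀, ht₀⟩ := hemp
        obtain ⟨ψ, hψ, j, hj⟩ := h.exists_witness hO hK hΦ hπ hconc hrole hne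
          (hΦ.connected φ hφ.1) ht₀
        exact h.witnesses j φ (h.negMem i hφ) ψ hψ hj
      -- The query without terms falls under the depth bound vacuously.
      · exact hclose fun t ht => absurd ⟨t, ht⟩ hemp

end IsRComplete

end Backward

end DLLite

theorem mainTheorem2
    {I V C P : Type} [Countable I] [Infinite I] [Countable V] [Infinite V]
    [Countable C] [Infinite C] [Countable P] [Infinite P]
    (RC : Set C) (RR : Set P)
    (K : DLLite.TKB I C P) (hHorn : K.onto.IsHorn) (hK : K.NamesInOntology)
    (Φ : DLLite.TCQ I V C P) (hΦ : Φ.Admissible K)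
    (k : ℕ) (W : Fin k → Set (DLLite.CQ I V C P)) (hW : ∀ l, W l ⊆ Φ.cqs)
    (ι : Fin (K.n + 1) → Fin k) :
    DLLite.RSatisfiable RC RR K Φ W ι ↔
      ∃ (AR : Set (DLLite.Assertion I C P)) (QR QRn : Set (DLLite.CQ I V C P))
        (RF : Set (DLLite.Role P × DLLite.Term I V)),
        DLLite.IsRComplete RC RR K Φ W ι AR QR QRn RF := by
  constructor
  · exact fun h => h.exists_isRComplete hHorn hK hΦ hW
  · rintro ⟨AR, QR, QRn, RF, h⟩
    exact h.rSatisfiable hHorn hK hΦ
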